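/- A $k$-graph is a hypergraph all of whose edges have exactly $k$ vertices. For a $k$-graph $F$, let $\mathrm{ex}(n,F)$ be the maximum number of edges of a $k$-graph on $n$ vertices that does not contain $F$ as a subgraph, and let $\pi(F)=\lim_{n\to\infty}\mathrm{ex}(n,F)/\binom nk$ be its Turán density. For an integer $k\ge 2$, let $t(k)$ be the largest integer $s\geq 1$ such that $\frac1s+\frac1{s+1}+\cdots+\frac1k>1$. For a partition $\lambda=(\lambda_1,\dots,\lambda_\ell)$ of $k$ with $\lambda_1\ge\cdots\ge\lambda_\ell\ge1$ and $\ell\ge 2$, the $\lambda$-tent $\Delta_\lambda$ is the $k$-graph (unique up to isomorphism) with $(k-1)\ell+1$ vertices and $\ell+1$ edges $e,e_1,\dots,e_\ell$ such that there is a vertex $v$ with $e_i\cap e_j=\{v\}$ for all $1\le i<j\le\ell$, and the sets $e\cap e_1,\dots,e\cap e_\ell$ form a partition of $e$ with $|e\cap e_i|=\lambda_i$ for every $i$. Let $\Sigma_\lambda=\{\sum_{i\in A}\lambda_i : A\subseteq\{1,\dots,\ell\}\}$ be the subset sum set of $\lambda$. Let $k\ge2$. If $\lambda$ is a partition of $k$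 with $\{1,\dots,t(k)\}\subseteq\Sigma_\lambda$ (which forces $\ell\ge2$), then $$\pi(\Delta_\lambda)=\frac{k!}{k^k}.$$ In particular, $\pi(\Delta_{(6,2,1)})=9!/9^9$, and for every $k\ge2$ and every integer $q$ with $1\le q\le k-t(k)$, the partition $(q,1,\dots,1)$ of $k$ satisfies $\pi(\Delta_{(q,1,\dots,1)})=k!/k^k$. -/

import Mathlib

open Filter Topology
open scoped Nat

namespace Hypergraph

/-- `G` is a `k`-graph: every edge is a set of exactly `k` vertices. -/
def IsUniform {β : Type*} (G : Hypergraph β) (k : ℕ) : Prop :=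
  ∀ e ∈ G.edgeSet, e.encard = k

/-- `G` contains (a copy of) `F` as a subgraph: there is an injection of the vertices of `F` into
the vertices of `G` that sends every edge of `F` to an edge of `G`. -/
def Contains {α β : Type*} (G : Hypergraph β) (F : Hypergraph α) : Prop :=
  ∃ f : α → β, Set.InjOn f F.vertexSet ∧ Set.MapsTo f F.vertexSet G.vertexSet ∧
    ∀ e ∈ F.edgeSet, f '' e ∈ G.edgeSet

/-- The Turán number `ex(n, 𝓕)` for `k`-graphs: the maximum number of edges of a `k`-graph
on `n` vertices that contains no member of `𝓕` as a subgraph. -/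
noncomputable def turanNumber {α : Type*} (k n : ℕ) (𝓕 : Set (Hypergraph α)) : ℕ :=
  sSup {m : ℕ | ∃ G : Hypergraph (Fin n), G.vertexSet = Set.univ ∧ G.IsUniform k ∧
    (∀ F ∈ 𝓕, ¬ G.Contains F) ∧ G.edgeSet.ncard = m}

/-- The Turán density of `𝓕` (as a family of `k`-graphs) exists and equals `d`, that is,
`ex(n, 𝓕) / binom(n, k)` tends to `d` as `n → ∞`. -/
def HasTuranDensity {α : Type*} (k : ℕ) (𝓕 : Set (Hypergraph α)) (d : ℝ) : Prop :=
  Tendsto (fun n : ℕ => (turanNumber k n 𝓕 : ℝ) / (n.choose k : ℝ)) atTop (𝓝 d)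

/-- `lam = (lam 0, …, lam (ℓ - 1))` is a partition of `k`:
a weakly decreasing sequence of positive integers with sum `k`. -/
def IsPartition {ℓ : ℕ} (lam : Fin ℓ → ℕ) (k : ℕ) : Prop :=
  Antitone lam ∧ (∀ i, 1 ≤ lam i) ∧ ∑ i, lam i = k

/-- The subset sum set of `lam`. -/
def subsetSums {ℓ : ℕ} (lam : Fin ℓ → ℕ) : Set ℕ :=
  {s | ∃ A : Finset (Fin ℓ), ∑ i ∈ A, lam i = s}

/-- The base edge `e` of the tent. The vertex `none` is the apex, and `some (i, j)` is the
`j`-th vertex different from the apex on the edge `eᵢ`; the edge `e` contains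
the first `lam i` of these, for each `i`. -/
def tentBase (k : ℕ) {ℓ : ℕ} (lam : Fin ℓ → ℕ) : Set (Option (Fin ℓ × Fin (k - 1))) :=
  {x | ∃ (i : Fin ℓ) (j : Fin (k - 1)), x = some (i, j) ∧ (j : ℕ) < lam i}

/-- The edge `eᵢ` of the tent: the apex together with the `k - 1` vertices `some (i, j)`. -/
def tentArm (k : ℕ) {ℓ : ℕ} (i : Fin ℓ) : Set (Option (Fin ℓ × Fin (k - 1))) :=
  {x | x = none ∨ ∃ j : Fin (k - 1), x = some (i, j)}

/-- The `lam`-tent: the hypergraph with `(k - 1) * ℓ + 1` vertices and the edges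
`e, e₁, …, e_ℓ`. The edges `eᵢ` meet pairwise exactly in the apex, and `e` is the disjoint union
of the sets `e ∩ eᵢ`, of size `lam i`. This is meant for partitions `lam` of `k` with at least
two parts. -/
def tent (k : ℕ) {ℓ : ℕ} (lam : Fin ℓ → ℕ) : Hypergraph (Option (Fin ℓ × Fin (k - 1))) where
  vertexSet := Set.univ
  edgeSet := {s | s = tentBase k lam ∨ ∃ i : Fin ℓ, s = tentArm k i}
  subset_vertexSet_of_mem_edgeSet' := fun _ _ => Set.subset_univ _

/-- `t(k)`: the largest integer `s` such that `1/s + 1/(s+1) + ⋯ + 1/k > 1`.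
(For `s > k` the sum is empty, so the search up to `k` loses nothing; for `k ≥ 2` the value
`s = 1` always qualifies.) -/
def tentThreshold (k : ℕ) : ℕ :=
  Nat.findGreatest (fun s => 1 < ∑ i ∈ Finset.Icc s k, (1 : ℚ) / (i : ℚ)) k

end Hypergraph

/-! Lower bound: in the complete `k`-partite `k`-graph the base of a tent would contain a vertex
from the part of the apex, yet that vertex shares an arm with the apex.

Upper bound, by entropy. Deleting `O(n^(k-1))` edges makes a tent-free graph extendable
(`exists_extendable_card_le`). Then a homomorphic image of the two-part tent with parts `s`, `k -
s`, where `s` is a subset sum, would blow up to a genuine tent (`contains_tent_of_extendable`), so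
there is none for `1 ≤ s ≤ t`. Let `(X₁, …, X_k)` be a uniform random ordered edge and `x i =
exp(H(X_{k-i+1} | X₁, …, X_{k-i}) - H(X₁))`. Then `x k = 1`, and by the chain rule `∏ x i` is the
number of ordered edges over `exp(k H(X₁)) ≤ n^k`. Absence of the two-part tent makes two sets of
candidate apices disjoint, which gives `x s + x j ≤ x (s + j)` for `s ≤ t`
(`exp_initialCoords_add_le`).

What remains is analytic. This restricted superadditivity and `1/(t+1) + ⋯ + 1/k ≤ 1`, which is the
maximality of `t(k)`, force `∑ x j / j ≤ x k` (`sum_div_le_of_superadditive`), and AM-GM turns that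
into `∏ x j ≤ k!/k^k`. -/

/-! ### The harmonic inequality for partially superadditive sequences. -/

/-- Abel summation: at each step the current weight is lowered, which only raises a nonpositive
partial sum. -/
theorem sum_mul_nonpos_of_antitone (x g : ℕ → ℝ) (M : ℕ)
    (hg : ∀ j, 1 ≤ j → j < M → g (j + 1) ≤ g j) (hg0 : ∀ j, 1 ≤ j → j ≤ M → 0 ≤ g j)
    (hS : ∀ m, m ≤ M → ∑ j ∈ Finset.Icc 1 m, x j ≤ 0) :
    ∑ j ∈ Finset.Icc 1 M, g j * x j ≤ 0 := by
  have key : ∀ m, 1 ≤ m → m ≤ M →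
      ∑ j ∈ Finset.Icc 1 m, g j * x j ≤ g m * ∑ j ∈ Finset.Icc 1 m, x j := by
    intro m hm
    induction m, hm using Nat.le_induction with
    | base => intro _; simp
    | succ m hm ih =>
      intro hmM
      rw [Finset.sum_Icc_succ_top (by omega), Finset.sum_Icc_succ_top (by omega), mul_add]
      have h1 := ih (by omega)
      have h2 := mul_le_mul_of_nonpos_right (hg m hm (by omega)) (hS m (by omega))
      linarith
  rcases Nat.eq_zero_or_pos M with rfl | hM
  · simp
  · exact (key M hM le_rfl).trans
      (mul_nonpos_of_nonneg_of_nonpos (hg0 M hM le_rfl) (hS M le_rfl))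

theorem sum_Icc_pred_reflect (x : ℕ → ℝ) (m : ℕ) :
    ∑ i ∈ Finset.Icc 1 (m - 1), x (m - i) = ∑ i ∈ Finset.Icc 1 (m - 1), x i := by
  refine Finset.sum_nbij' (fun i => m - i) (fun i => m - i) ?_ ?_ ?_ ?_ ?_ <;>
    simp only [Finset.mem_Icc] <;> intros <;> first | omega | rfl | trivial

theorem two_mul_sum_le_of_superadditive (x : ℕ → ℝ) (m : ℕ)
    (h : ∀ i, 1 ≤ i → i < m → x i + x (m - i) ≤ x m) :
    2 * ∑ i ∈ Finset.Icc 1 (m - 1), x i ≤ ((m - 1 : ℕ) : ℝ) * x m := by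
  have h1 : ∑ i ∈ Finset.Icc 1 (m - 1), (x i + x (m - i)) ≤ ∑ i ∈ Finset.Icc 1 (m - 1), x m := by
    refine Finset.sum_le_sum fun i hi => ?_
    rw [Finset.mem_Icc] at hi
    exact h i hi.1 (by omega)
  rw [Finset.sum_add_distrib, sum_Icc_pred_reflect] at h1
  simp only [Finset.sum_const, Nat.card_Icc, nsmul_eq_mul, Nat.add_sub_cancel] at h1
  linarith

/-- Downward induction: if the sum up to `m` were positive, pairing `i` with `m + 1 - i` would make
`x (m + 1)` positive, hence also the sum up to `m + 1`. -/
theorem partial_sums_nonpos (x : ℕ → ℝ) (M : ℕ) (hM : ∑ i ∈ Finset.Icc 1 M, x i = 0)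
    (h : ∀ m i, m ≤ M → 1 ≤ i → i < m → x i + x (m - i) ≤ x m) (m : ℕ) (hm : m ≤ M) :
    ∑ i ∈ Finset.Icc 1 m, x i ≤ 0 := by
  induction hm using Nat.decreasingInduction with
  | self => exact hM.le
  | of_succ m hm ih =>
    rcases Nat.eq_zero_or_pos m with rfl | hpos
    · simp
    rw [Finset.sum_Icc_succ_top (by omega)] at ih
    have h1 := two_mul_sum_le_of_superadditive x (m + 1) (fun i hi hi' => h (m + 1) i hm hi hi')
    simp only [Nat.add_sub_cancel] at h1
    have hm0 : (0 : ℝ) < m := by exact_mod_cast hpos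
    by_contra hcon
    push Not at hcon
    nlinarith

/-- A sequence summing to zero over `[1, t]`, superadditive when one summand is at most `t`, has
nonnegative increments over final windows of length at least `t`. -/
theorem increment_nonneg (x : ℕ → ℝ) (k t : ℕ) (ht : 1 ≤ t) (hx0 : x 0 = 0)
    (hS : ∑ i ∈ Finset.Icc 1 t, x i = 0)
    (hsup : ∀ i j, 1 ≤ i → i ≤ t → i + j ≤ k → x i + x j ≤ x (i + j))
    (L : ℕ) (htL : t < L) (hLk : L ≤ k) : x (k - L) ≤ x k := by
  have hpart : ∀ m, m ≤ t → ∑ i ∈ Finset.Icc 1 m, x i ≤ 0 := fun m hm =>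
    partial_sums_nonpos x t hS (fun m i hm hi him => by
      have := hsup i (m - i) hi (by omega) (by omega)
      rwa [show i + (m - i) = m by omega] at this) m hm
  induction L using Nat.strong_induction_on with
  | _ L ih =>
    -- Shorter windows: superadditivity handles `j ≤ t`, the induction hypothesis the rest.
    have hlow : ∀ j, j < L → (if j ≤ t then x j else 0) ≤ x k - x (k - j) := by
      intro j hj
      split_ifs with hjt
      · rcases Nat.eq_zero_or_pos j with rfl | hj0
        · simp [hx0]
        · have := hsup j (k - j) hj0 hjt (by omega)
          rw [show j + (k - j) = k by omega] at this
          linarith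
      · linarith [ih j hj (by omega) (by omega)]
    -- These terms form a tail of a block with sum zero, and the complementary initial sum is
    -- nonpositive.
    have hz : 0 ≤ ∑ i ∈ Finset.Icc 1 t, (if L - i ≤ t then x (L - i) else 0) := by
      have h1 : ∑ i ∈ Finset.Icc 1 t, (if L - i ≤ t then x (L - i) else 0)
          = ∑ j ∈ Finset.Icc (L - t) t, x j := by
        rw [← Finset.sum_filter]
        refine Finset.sum_nbij' (fun i => L - i) (fun i => L - i) ?_ ?_ ?_ ?_ ?_ <;>
          simp only [Finset.mem_Icc, Finset.mem_filter] <;> intros <;> first | omega | rfl | trivial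
      rw [h1]
      by_cases hL2 : L - t ≤ t
      · have h2 : ∑ j ∈ Finset.Icc 1 (L - t - 1), x j + ∑ j ∈ Finset.Icc (L - t) t, x j
            = ∑ j ∈ Finset.Icc 1 t, x j := by
          have e1 : Finset.Icc 1 (L - t - 1) = Finset.Ico 1 (L - t) := by
            ext a; simp only [Finset.mem_Icc, Finset.mem_Ico]; omega
          have e2 : Finset.Icc (L - t) t = Finset.Ico (L - t) (t + 1) := by
            ext a; simp only [Finset.mem_Icc, Finset.mem_Ico]; omega
          have e3 : Finset.Icc 1 t = Finset.Ico 1 (t + 1) := by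
            ext a; simp only [Finset.mem_Icc, Finset.mem_Ico]; omega
          rw [e1, e2, e3]
          exact Finset.sum_Ico_consecutive _ (by omega) (by omega)
        have h3 := hpart (L - t - 1) (by omega)
        linarith
      · rw [Finset.Icc_eq_empty (by omega)]; simp
    -- Split the window at each `i ≤ t`, using `x i + x (k - L) ≤ x (k - (L - i))`, and add up.
    have hsum : ∑ i ∈ Finset.Icc 1 t, ((if L - i ≤ t then x (L - i) else 0) + x i)
        ≤ ∑ i ∈ Finset.Icc 1 t, (x k - x (k - L)) := by
      refine Finset.sum_le_sum fun i hi => ?_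
      rw [Finset.mem_Icc] at hi
      have h1 := hlow (L - i) (by omega)
      have h2 := hsup i (k - L) hi.1 hi.2 (by omega)
      rw [show i + (k - L) = k - (L - i) by omega] at h2
      linarith
    rw [Finset.sum_add_distrib, hS, Finset.sum_const, Nat.card_Icc, nsmul_eq_mul] at hsum
    have ht0 : (0 : ℝ) < ((t + 1 - 1 : ℕ) : ℝ) := by simp; omega
    by_contra hcon
    push Not at hcon
    nlinarith

/-- For `k ≤ 2t` every pair with `i + j ≤ k` has a summand at most `t`, so superadditivity is
unrestricted. With sum zero below `k`, pairing gives `x k ≥ 0` and Abel summation makes the terms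
below `k` contribute at most zero, leaving `x k / k`. -/
theorem sum_div_le_of_half_le (x : ℕ → ℝ) (k t : ℕ) (htk : k ≤ 2 * t) (hk : 1 ≤ k)
    (hS : ∑ i ∈ Finset.Icc 1 (k - 1), x i = 0)
    (hsup : ∀ i j, 1 ≤ i → i ≤ t → i + j ≤ k → x i + x j ≤ x (i + j)) :
    ∑ j ∈ Finset.Icc 1 k, x j / j ≤ x k := by
  have hfull : ∀ m i, m ≤ k → 1 ≤ i → i < m → x i + x (m - i) ≤ x m := by
    intro m i hm hi him
    by_cases hit : i ≤ t
    · have := hsup i (m - i) hi hit (by omega)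
      rwa [show i + (m - i) = m by omega] at this
    · have := hsup (m - i) i (by omega) (by omega) (by omega)
      rw [show m - i + i = m by omega] at this
      linarith
  obtain ⟨k, rfl⟩ : ∃ m, k = m + 1 := ⟨k - 1, by omega⟩
  simp only [Nat.add_sub_cancel] at hS
  have hpart := partial_sums_nonpos x k hS (fun m i hm => hfull m i (by omega))
  have h1 := sum_mul_nonpos_of_antitone x (fun j => 1 / (j : ℝ)) k
    (fun j hj _ => one_div_le_one_div_of_le (by exact_mod_cast hj) (by push_cast; linarith))
    (fun j _ _ => by positivity) hpart
  have h2 := two_mul_sum_le_of_superadditive x (k + 1) (fun i hi hi' => hfull (k + 1) i le_rfl hi hi')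
  simp only [Nat.add_sub_cancel, hS] at h2
  rw [Finset.sum_Icc_succ_top (by omega)]
  have h3 : ∑ j ∈ Finset.Icc 1 k, x j / j ≤ 0 := by
    refine le_trans (le_of_eq (Finset.sum_congr rfl fun j _ => ?_)) h1
    ring
  rcases Nat.eq_zero_or_pos k with rfl | hk0
  · simp
  have hk0' : (0 : ℝ) < k := by exact_mod_cast hk0
  have hx : 0 ≤ x (k + 1) := by
    by_contra hcon
    push Not at hcon
    nlinarith
  have h4 : x (k + 1) / ((k + 1 : ℕ) : ℝ) ≤ x (k + 1) :=
    div_le_self hx (by push_cast; linarith)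
  linarith

/-- For `j > t`, bound `x j` by `x k`, minus `x (k - j)` when `k - j ≤ t`. The corrections change
the weights of the first block to `1/j - 1/(k-j)`, decreasing and nonnegative because `j ≤ t < k/2`;
Abel summation applies, and `x k` is left with weight `∑_{j>t} 1/j ≤ 1`. -/
theorem sum_div_le_of_lt_half (x : ℕ → ℝ) (k t : ℕ) (ht : 1 ≤ t) (htk : 2 * t < k)
    (hx0 : x 0 = 0) (hS : ∑ i ∈ Finset.Icc 1 t, x i = 0)
    (hsup : ∀ i j, 1 ≤ i → i ≤ t → i + j ≤ k → x i + x j ≤ x (i + j))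
    (hT : ∑ j ∈ Finset.Icc (t + 1) k, (1 : ℝ) / j ≤ 1) :
    ∑ j ∈ Finset.Icc 1 k, x j / j ≤ x k := by
  have hpart : ∀ m, m ≤ t → ∑ i ∈ Finset.Icc 1 m, x i ≤ 0 := fun m hm =>
    partial_sums_nonpos x t hS (fun m i hm hi him => by
      have := hsup i (m - i) hi (by omega) (by omega)
      rwa [show i + (m - i) = m by omega] at this) m hm
  have hinc := increment_nonneg x k t ht hx0 hS hsup
  have hxk : 0 ≤ x k := by
    have := hinc k (by omega) le_rfl
    simpa [hx0] using this
  have hcast : ∀ j : ℕ, j ≤ t → (0 : ℝ) < ((k - j : ℕ) : ℝ) := fun j hj => by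
    exact_mod_cast (by omega : 0 < k - j)
  have hA := sum_mul_nonpos_of_antitone x (fun j => 1 / (j : ℝ) - 1 / ((k - j : ℕ) : ℝ)) t
    (fun j hj hjt => by
      have h1 : (1 : ℝ) / ((j + 1 : ℕ) : ℝ) ≤ 1 / j :=
        one_div_le_one_div_of_le (by exact_mod_cast hj) (by push_cast; linarith)
      have h2 : (1 : ℝ) / ((k - j : ℕ) : ℝ) ≤ 1 / ((k - (j + 1) : ℕ) : ℝ) :=
        one_div_le_one_div_of_le (hcast _ (by omega)) (by exact_mod_cast (by omega))
      linarith)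
    (fun j hj hjt => by
      have h1 : (1 : ℝ) / ((k - j : ℕ) : ℝ) ≤ 1 / j :=
        one_div_le_one_div_of_le (by exact_mod_cast hj) (by exact_mod_cast (by omega))
      linarith) hpart
  have hB : ∑ j ∈ Finset.Icc (t + 1) k, x j / j
      ≤ ∑ j ∈ Finset.Icc (t + 1) k, (x k * (1 / j) -
          (if k - j ≤ t then x (k - j) / j else 0)) := by
    refine Finset.sum_le_sum fun j hj => ?_
    rw [Finset.mem_Icc] at hj
    have hj0 : (0 : ℝ) < j := by exact_mod_cast (by omega : 0 < j)
    have : x j ≤ x k - (if k - j ≤ t then x (k - j) else 0) := by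
      split_ifs with hjt
      · rcases Nat.eq_zero_or_pos (k - j) with h | h
        · rw [h, hx0, show j = k by omega]; simp
        · have := hsup (k - j) j h hjt (by omega)
          rw [show k - j + j = k by omega] at this
          linarith
      · have := hinc (k - j) (by omega) (by omega)
        rw [show k - (k - j) = j by omega] at this
        linarith
    have h2 := div_le_div_of_nonneg_right this hj0.le
    refine h2.trans (le_of_eq ?_)
    split_ifs <;> ring
  have hC : ∑ j ∈ Finset.Icc (t + 1) k, (if k - j ≤ t then x (k - j) / j else 0)
      = ∑ j ∈ Finset.Icc 1 t, x j / ((k - j : ℕ) : ℝ) := by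
    rw [← Finset.sum_filter]
    have : (Finset.Icc (t + 1) k).filter (fun j => k - j ≤ t) = insert k (Finset.Ico (k - t) k) := by
      ext a; simp only [Finset.mem_Icc, Finset.mem_Ico, Finset.mem_filter, Finset.mem_insert]; omega
    rw [this, Finset.sum_insert (by simp), Nat.sub_self, hx0, zero_div, zero_add]
    refine Finset.sum_nbij' (fun i => k - i) (fun i => k - i) ?_ ?_ ?_ ?_ ?_ <;>
      simp only [Finset.mem_Icc, Finset.mem_Ico] <;> intro a ha <;> try omega
    rw [show k - (k - a) = a by omega]
  rw [Finset.sum_sub_distrib, hC, ← Finset.mul_sum] at hB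
  have hD : ∑ j ∈ Finset.Icc 1 k, x j / j
      = ∑ j ∈ Finset.Icc 1 t, x j / j + ∑ j ∈ Finset.Icc (t + 1) k, x j / j := by
    have e : ∀ a b, Finset.Icc a b = Finset.Ico a (b + 1) := fun a b => by
      ext; simp only [Finset.mem_Icc, Finset.mem_Ico]; omega
    rw [e, e, e, Finset.sum_Ico_consecutive _ (by omega) (by omega)]
  have hE : ∑ j ∈ Finset.Icc 1 t, x j / j - ∑ j ∈ Finset.Icc 1 t, x j / ((k - j : ℕ) : ℝ) ≤ 0 := by
    rw [← Finset.sum_sub_distrib]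
    refine le_trans (le_of_eq (Finset.sum_congr rfl fun j _ => ?_)) hA
    ring
  have hF := mul_le_mul_of_nonneg_left hT hxk
  linarith

theorem exists_shift_sum_eq_zero (x : ℕ → ℝ) (M : ℕ) :
    ∃ a : ℝ, ∑ i ∈ Finset.Icc 1 M, (x i - a * i) = 0 := by
  rcases Nat.eq_zero_or_pos M with rfl | hM
  · exact ⟨0, by simp⟩
  have hpos : 0 < ∑ i ∈ Finset.Icc 1 M, (i : ℝ) :=
    Finset.sum_pos (fun i hi => by rw [Finset.mem_Icc] at hi; exact_mod_cast hi.1)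
      ⟨1, by simp; omega⟩
  refine ⟨(∑ i ∈ Finset.Icc 1 M, x i) / ∑ i ∈ Finset.Icc 1 M, (i : ℝ), ?_⟩
  rw [Finset.sum_sub_distrib, ← Finset.mul_sum]
  field_simp
  ring

/-- The harmonic inequality for sequences that are superadditive when one summand is at most
`t`. -/
theorem sum_div_le_of_superadditive (x : ℕ → ℝ) (k t : ℕ) (ht : 1 ≤ t) (hk : 1 ≤ k)
    (hx0 : x 0 = 0)
    (hsup : ∀ i j, 1 ≤ i → i ≤ t → i + j ≤ k → x i + x j ≤ x (i + j))
    (hT : ∑ j ∈ Finset.Icc (t + 1) k, (1 : ℝ) / j ≤ 1) :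
    ∑ j ∈ Finset.Icc 1 k, x j / j ≤ x k := by
  -- Subtracting a linear sequence preserves both superadditivity and the conclusion, since `∑ a j /
  -- j = a k`. This freedom is spent on making an initial sum vanish.
  have shift : ∀ a : ℝ, ∑ j ∈ Finset.Icc 1 k, (x j - a * j) / j ≤ x k - a * k →
      ∑ j ∈ Finset.Icc 1 k, x j / j ≤ x k := by
    intro a h
    have : ∑ j ∈ Finset.Icc 1 k, (x j - a * j) / j
        = ∑ j ∈ Finset.Icc 1 k, x j / j - a * k := by
      have : ∀ j ∈ Finset.Icc 1 k, (x j - a * j) / j = x j / j - a := by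
        intro j hj
        rw [Finset.mem_Icc] at hj
        have : (j : ℝ) ≠ 0 := by exact_mod_cast (by omega)
        field_simp
      rw [Finset.sum_congr rfl this, Finset.sum_sub_distrib]
      simp [mul_comm]
    linarith
  have hsup' : ∀ a : ℝ, ∀ i j, 1 ≤ i → i ≤ t → i + j ≤ k →
      (x i - a * i) + (x j - a * j) ≤ x (i + j) - a * ((i + j : ℕ) : ℝ) := by
    intro a i j h1 h2 h3
    have := hsup i j h1 h2 h3
    push_cast
    linarith
  by_cases htk : k ≤ 2 * t
  · obtain ⟨a, ha⟩ := exists_shift_sum_eq_zero x (k - 1)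
    exact shift a (sum_div_le_of_half_le (fun j => x j - a * j) k t htk hk ha (hsup' a))
  · obtain ⟨a, ha⟩ := exists_shift_sum_eq_zero x t
    exact shift a (sum_div_le_of_lt_half (fun j => x j - a * j) k t ht (by omega)
      (by simp [hx0]) ha (hsup' a) hT)

/-- AM-GM via `y ≤ exp (y - 1)` for `y = k x j / j`; these numbers add up to at most `k`. -/
theorem prod_le_factorial_div_pow (x : ℕ → ℝ) (k t : ℕ) (ht : 1 ≤ t) (hk : 1 ≤ k)
    (hx0 : x 0 = 0) (hxk : x k = 1) (hnn : ∀ j, 0 ≤ x j)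
    (hsup : ∀ i j, 1 ≤ i → i ≤ t → i + j ≤ k → x i + x j ≤ x (i + j))
    (hT : ∑ j ∈ Finset.Icc (t + 1) k, (1 : ℝ) / j ≤ 1) :
    ∏ j ∈ Finset.Icc 1 k, x j ≤ (k ! : ℝ) / (k : ℝ) ^ k := by
  have h1 := sum_div_le_of_superadditive x k t ht hk hx0 hsup hT
  rw [hxk] at h1
  have hk0 : (0 : ℝ) < k := by exact_mod_cast hk
  have h2 : ∏ j ∈ Finset.Icc 1 k, (k * (x j / j)) ≤ 1 := by
    calc ∏ j ∈ Finset.Icc 1 k, (k * (x j / j))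
        ≤ ∏ j ∈ Finset.Icc 1 k, Real.exp (k * (x j / j) - 1) := by
          refine Finset.prod_le_prod (fun j _ => ?_) (fun j _ => ?_)
          · have := hnn j
            positivity
          · have := Real.add_one_le_exp (k * (x j / j) - 1)
            linarith
      _ = Real.exp (k * ∑ j ∈ Finset.Icc 1 k, x j / j - k) := by
          rw [← Real.exp_sum, Finset.sum_sub_distrib, ← Finset.mul_sum]
          simp
      _ ≤ 1 := by
          rw [Real.exp_le_one_iff]
          nlinarith
  have h3 : ∏ j ∈ Finset.Icc 1 k, (k * (x j / j))
      = (k : ℝ) ^ k * (∏ j ∈ Finset.Icc 1 k, x j) / k ! := by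
    rw [Finset.prod_mul_distrib, Finset.prod_div_distrib, show (k ! : ℝ) = ∏ j ∈ Finset.Icc 1 k, (j : ℝ) by
      rw [← Finset.prod_Ico_id_eq_factorial, Nat.cast_prod]; rfl]
    simp [mul_div_assoc]
  rw [h3, div_le_one (by positivity)] at h2
  rw [le_div_iff₀ (by positivity)]
  linarith

/-! ### Entropy of symmetric sets of tuples. -/

/-- The tuples in `Ω` that agree with `f` on `I`. -/
def agreeing {ι V : Type*} [DecidableEq V] (Ω : Finset (ι → V)) (I : Finset ι) (f : ι → V) :
    Finset (ι → V) :=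
  Ω.filter fun g => ∀ i ∈ I, g i = f i

section Entropy

variable {ι V : Type*} [DecidableEq V]

theorem mem_agreeing {Ω : Finset (ι → V)} {I : Finset ι} {f g : ι → V} :
    g ∈ agreeing Ω I f ↔ g ∈ Ω ∧ ∀ i ∈ I, g i = f i := Finset.mem_filter

theorem self_mem_agreeing {Ω : Finset (ι → V)} (I : Finset ι) {f : ι → V} (hf : f ∈ Ω) :
    f ∈ agreeing Ω I f := mem_agreeing.2 ⟨hf, fun _ _ => rfl⟩

theorem card_agreeing_pos {Ω : Finset (ι → V)} (I : Finset ι) {f : ι → V} (hf : f ∈ Ω) :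
    (0 : ℝ) < (agreeing Ω I f).card := by
  exact_mod_cast Finset.card_pos.2 ⟨f, self_mem_agreeing I hf⟩

theorem agreeing_congr {Ω : Finset (ι → V)} {I : Finset ι} {f g : ι → V}
    (h : ∀ i ∈ I, f i = g i) : agreeing Ω I f = agreeing Ω I g := by
  ext a
  simp only [mem_agreeing]
  exact and_congr_right fun _ => forall₂_congr fun i hi => by rw [h i hi]

/-- The average over `f ∈ Ω` of the logarithm of the number of tuples agreeing with `f` on `I`.
Up to the constant `log #Ω`, this is minus the entropy of the marginal on `I` of a uniform random
element of `Ω`. -/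
noncomputable def meanLog (Ω : Finset (ι → V)) (I : Finset ι) : ℝ :=
  (∑ f ∈ Ω, Real.log (agreeing Ω I f).card) / Ω.card

/-- `Ω` is closed under permuting coordinates. -/
def PermClosed (Ω : Finset (ι → V)) : Prop :=
  ∀ f ∈ Ω, ∀ σ : Equiv.Perm ι, f ∘ σ ∈ Ω

theorem card_agreeing_map {Ω : Finset (ι → V)} (h : PermClosed Ω) (σ : Equiv.Perm ι)
    (I : Finset ι) (f : ι → V) :
    (agreeing Ω (I.map σ.toEmbedding) f).card = (agreeing Ω I (f ∘ σ)).card := by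
  refine Finset.card_nbij' (fun g => g ∘ σ) (fun g => g ∘ σ.symm) ?_ ?_ ?_ ?_
  · intro g hg
    simp only [Finset.mem_coe, mem_agreeing, Finset.mem_map, forall_exists_index, and_imp,
      forall_apply_eq_imp_iff₂, Equiv.coe_toEmbedding] at hg ⊢
    exact ⟨h g hg.1 σ, fun i hi => hg.2 i hi⟩
  · intro g hg
    simp only [Finset.mem_coe, mem_agreeing, Finset.mem_map, forall_exists_index, and_imp,
      forall_apply_eq_imp_iff₂, Equiv.coe_toEmbedding] at hg ⊢
    exact ⟨h g hg.1 σ.symm, fun i hi => by simpa using hg.2 i hi⟩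
  · intro g _; ext; simp
  · intro g _; ext; simp

theorem meanLog_eq_of_card_eq {Ω : Finset (ι → V)} (h : PermClosed Ω) {I J : Finset ι}
    (hIJ : I.card = J.card) : meanLog Ω I = meanLog Ω J := by
  obtain ⟨σ, rfl⟩ := Equiv.Perm.exists_map_finset_eq I J hIJ
  unfold meanLog
  congr 1
  simp_rw [card_agreeing_map h]
  symm
  refine Finset.sum_nbij' (fun g => g ∘ σ) (fun g => g ∘ σ.symm) ?_ ?_ ?_ ?_ ?_
  · exact fun g hg => h g hg σ
  · exact fun g hg => h g hg σ.symm
  · intro g _; ext; simp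
  · intro g _; ext; simp
  · intro g _; rfl

/-- Jensen's inequality, from `log y ≤ y - 1` at `y = r a / A` with `A` the mean. -/
theorem exp_mean_log_le_mean {α : Type*} (s : Finset α) (r : α → ℝ) (hr : ∀ a ∈ s, 0 < r a)
    (hs : s.Nonempty) :
    Real.exp ((∑ a ∈ s, Real.log (r a)) / s.card) ≤ (∑ a ∈ s, r a) / s.card := by
  have hN : (0 : ℝ) < s.card := by exact_mod_cast hs.card_pos
  have hA : 0 < (∑ a ∈ s, r a) / s.card := div_pos (Finset.sum_pos hr hs) hN
  rw [← Real.le_log_iff_exp_le hA, div_le_iff₀ hN]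
  set A := (∑ a ∈ s, r a) / s.card with hAdef
  have h1 : ∑ a ∈ s, (Real.log (r a) - Real.log A) ≤ ∑ a ∈ s, (r a / A - 1) := by
    refine Finset.sum_le_sum fun a ha => ?_
    rw [← Real.log_div (hr a ha).ne' hA.ne']
    exact Real.log_le_sub_one_of_pos (div_pos (hr a ha) hA)
  have h2 : ∑ a ∈ s, r a = A * s.card := by
    rw [hAdef, div_mul_cancel₀ _ hN.ne']
  rw [Finset.sum_sub_distrib, Finset.sum_sub_distrib, ← Finset.sum_div, h2] at h1
  simp only [Finset.sum_const, nsmul_eq_mul] at h1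
  have h3 : A * s.card / A = s.card := mul_div_cancel_left₀ _ hA.ne'
  rw [h3] at h1
  linarith

/-- The values at coordinate `c` of the tuples agreeing with `f` on `W`. -/
def extensions (Ω : Finset (ι → V)) (W : Finset ι) (c : ι) (f : ι → V) : Finset V :=
  (agreeing Ω W f).image fun g => g c

variable [DecidableEq ι]

/-- Double counting: the numerator on the left counts pairs `(f', g)`, with `f'` agreeing with `f`
on `W` and `g` agreeing with `f` on `insert c Z`. For a fixed pair the possible `f` lie in one
agreement class of `insert c W`, whose size cancels. -/
theorem sum_ratio_le (Ω : Finset (ι → V)) (Z W : Finset ι) (hZW : Z ⊆ W) (c : ι) :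
    ∑ f ∈ Ω, ((agreeing Ω W f).card * (agreeing Ω (insert c Z) f).card : ℝ) /
        ((agreeing Ω (insert c W) f).card * (agreeing Ω Z f).card)
      ≤ ∑ f ∈ Ω, (((agreeing Ω Z f).filter fun g => g c ∈ extensions Ω W c f).card : ℝ) /
          (agreeing Ω Z f).card := by
  classical
  have h1 : ∀ f ∈ Ω, ((agreeing Ω W f).card * (agreeing Ω (insert c Z) f).card : ℝ) /
        ((agreeing Ω (insert c W) f).card * (agreeing Ω Z f).card)
      = ∑ f' ∈ Ω, ∑ g ∈ Ω, if f' ∈ agreeing Ω W f ∧ g ∈ agreeing Ω (insert c Z) f then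
          1 / ((agreeing Ω (insert c W) f).card * (agreeing Ω Z f).card : ℝ) else 0 := by
    intro f _
    rw [← Finset.sum_product', ← Finset.sum_filter, Finset.sum_const]
    have : (Ω ×ˢ Ω).filter (fun p => p.1 ∈ agreeing Ω W f ∧ p.2 ∈ agreeing Ω (insert c Z) f)
        = agreeing Ω W f ×ˢ agreeing Ω (insert c Z) f := by
      ext p
      simp only [Finset.mem_filter, Finset.mem_product, mem_agreeing]
      tauto
    rw [this, Finset.card_product, nsmul_eq_mul]
    push_cast
    ring
  have h2 : ∀ f ∈ Ω, (((agreeing Ω Z f).filter fun g => g c ∈ extensions Ω W c f).card : ℝ) /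
          (agreeing Ω Z f).card
      = ∑ g ∈ Ω, if g ∈ agreeing Ω Z f ∧ g c ∈ extensions Ω W c f then
          1 / ((agreeing Ω Z f).card : ℝ) else 0 := by
    intro f _
    rw [← Finset.sum_filter, Finset.sum_const, nsmul_eq_mul, ← Finset.filter_filter]
    have : Ω.filter (fun g => g ∈ agreeing Ω Z f) = agreeing Ω Z f := by
      ext p
      simp only [Finset.mem_filter, mem_agreeing]
      tauto
    rw [this]
    ring
  rw [Finset.sum_congr rfl h1, Finset.sum_congr rfl h2, Finset.sum_comm]
  refine Finset.sum_le_sum fun f' hf' => ?_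
  rw [Finset.sum_comm]
  refine Finset.sum_le_sum fun g hg => ?_
  have hZ : ∀ f, f' ∈ agreeing Ω W f → agreeing Ω Z f = agreeing Ω Z f' := fun f hf =>
    agreeing_congr fun i hi => ((mem_agreeing.1 hf).2 i (hZW hi)).symm
  split_ifs with hcond
  · obtain ⟨f₀, hf₀, hf₀c⟩ := Finset.mem_image.1 hcond.2
    rw [mem_agreeing] at hf₀
    rw [← Finset.sum_filter]
    have hT : ∀ f ∈ Ω.filter (fun f => f' ∈ agreeing Ω W f ∧ g ∈ agreeing Ω (insert c Z) f),
        f ∈ agreeing Ω (insert c W) f₀ := by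
      intro f hf
      simp only [Finset.mem_filter, mem_agreeing, Finset.mem_insert, forall_eq_or_imp] at hf ⊢
      refine ⟨hf.1, ?_, fun i hi => ?_⟩
      · rw [← hf.2.2.2.1, ← hf₀c]
      · rw [← hf.2.1.2 i hi, hf₀.2 i hi]
    calc _ ≤ ∑ f ∈ agreeing Ω (insert c W) f₀,
          1 / ((agreeing Ω (insert c W) f₀).card * (agreeing Ω Z f').card : ℝ) := by
          rw [Finset.sum_congr rfl (g := fun _ =>
            1 / ((agreeing Ω (insert c W) f₀).card * (agreeing Ω Z f').card : ℝ))]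
          · exact Finset.sum_le_sum_of_subset_of_nonneg hT fun _ _ _ => by positivity
          · intro f hf
            have h3 := hT f hf
            rw [hZ f (Finset.mem_filter.1 hf).2.1, agreeing_congr (mem_agreeing.1 h3).2]
      _ = 1 / (agreeing Ω Z f').card := by
          have := card_agreeing_pos (insert c W) hf₀.1
          rw [Finset.sum_const, nsmul_eq_mul]
          field_simp
  · refine le_of_eq (Finset.sum_eq_zero fun f hf => ?_)
    rw [if_neg]
    rintro ⟨h3, h4⟩
    refine hcond ⟨?_, ?_⟩
    · rw [← hZ f h3]
      rw [mem_agreeing] at h4 ⊢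
      exact ⟨hg, fun i hi => h4.2 i (Finset.mem_insert_of_mem hi)⟩
    · rw [mem_agreeing] at h3 h4
      refine Finset.mem_image.2 ⟨f, mem_agreeing.2 ⟨hf, fun i hi => (h3.2 i hi).symm⟩, ?_⟩
      exact (h4.2 c (Finset.mem_insert_self c Z)).symm

/-- The exponent is `H(X_c | X_W) - H(X_c | X_Z)`. The right side is the mean probability that a
`Z`-conditional sample at `c` is a value possible given `W`. -/
theorem exp_meanLog_le (Ω : Finset (ι → V)) (hΩ : Ω.Nonempty) (Z W : Finset ι) (hZW : Z ⊆ W)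
    (c : ι) :
    Real.exp ((meanLog Ω W - meanLog Ω (insert c W)) - (meanLog Ω Z - meanLog Ω (insert c Z)))
      ≤ (∑ f ∈ Ω, (((agreeing Ω Z f).filter fun g => g c ∈ extensions Ω W c f).card : ℝ) /
          (agreeing Ω Z f).card) / Ω.card := by
  refine le_trans (le_of_eq ?_) ((exp_mean_log_le_mean Ω
    (fun f => ((agreeing Ω W f).card * (agreeing Ω (insert c Z) f).card : ℝ) /
        ((agreeing Ω (insert c W) f).card * (agreeing Ω Z f).card)) ?_ hΩ).trans ?_)
  · congr 1
    simp only [meanLog]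
    rw [← sub_div, ← sub_div, ← sub_div, ← Finset.sum_sub_distrib, ← Finset.sum_sub_distrib,
      ← Finset.sum_sub_distrib]
    congr 1
    refine Finset.sum_congr rfl fun f hf => ?_
    have h1 := card_agreeing_pos W hf
    have h2 := card_agreeing_pos (insert c Z) hf
    have h3 := card_agreeing_pos (insert c W) hf
    have h4 := card_agreeing_pos Z hf
    rw [Real.log_div (by positivity) (by positivity), Real.log_mul h1.ne' h2.ne',
      Real.log_mul h3.ne' h4.ne']
    ring
  · intro f hf
    have h1 := card_agreeing_pos W hf
    have h2 := card_agreeing_pos (insert c Z) hf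
    have h3 := card_agreeing_pos (insert c W) hf
    have h4 := card_agreeing_pos Z hf
    positivity
  · exact div_le_div_of_nonneg_right (sum_ratio_le Ω Z W hZW c) (by positivity)

/-- `Ω` contains no tuples forming a homomorphic image of the tent with parts of sizes
`s` and `k - s`. -/
def TentFree (Ω : Finset (ι → V)) (s : ℕ) : Prop :=
  ∀ f ∈ Ω, ∀ g ∈ Ω, ∀ g' ∈ Ω, ∀ S : Finset ι, S.card = s → ∀ c ∈ S, ∀ c' ∉ S,
    (∀ i ∉ S, g i = f i) → (∀ i ∈ S, g' i = f i) → g c ≠ g' c'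

/-- Transposing `c` and `c'` fixes `Z` pointwise, so values at two different coordinates can be
compared in one probability space. -/
theorem card_agreeing_filter_swap {Ω : Finset (ι → V)} (h : PermClosed Ω) (Z : Finset ι)
    (c c' : ι) (hc : c ∉ Z) (hc' : c' ∉ Z) (f : ι → V) (N : Finset V) :
    ((agreeing Ω Z f).filter fun g => g c' ∈ N).card
      = ((agreeing Ω Z f).filter fun g => g c ∈ N).card := by
  have hfix : ∀ i ∈ Z, Equiv.swap c c' i = i := fun i hi =>
    Equiv.swap_apply_of_ne_of_ne (fun e => hc (e ▸ hi)) (fun e => hc' (e ▸ hi))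
  refine Finset.card_nbij' (fun g => g ∘ Equiv.swap c c') (fun g => g ∘ Equiv.swap c c') ?_ ?_ ?_ ?_
  · intro g hg
    simp only [Finset.mem_coe, Finset.mem_filter, mem_agreeing, Function.comp_apply,
      Equiv.swap_apply_left] at hg ⊢
    exact ⟨⟨h g hg.1.1 _, fun i hi => by rw [hfix i hi, hg.1.2 i hi]⟩, hg.2⟩
  · intro g hg
    simp only [Finset.mem_coe, Finset.mem_filter, mem_agreeing, Function.comp_apply,
      Equiv.swap_apply_right] at hg ⊢
    exact ⟨⟨h g hg.1.1 _, fun i hi => by rw [hfix i hi, hg.1.2 i hi]⟩, hg.2⟩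
  · intro g _; ext; simp
  · intro g _; ext; simp

/-- A value possible at `c` given the coordinates off `P`, and also at `c'` given those off `Q`,
would be the apex of a two-part tent. The two value sets are thus disjoint and their conditional
probabilities add up to at most one. -/
theorem exp_meanLog_add_exp_meanLog_le [Fintype ι] {Ω : Finset (ι → V)} (hΩ : Ω.Nonempty)
    (h : PermClosed Ω) (P Q Z : Finset ι) (hPQ : Disjoint P Q) (hPZ : Disjoint P Z)
    (hQZ : Disjoint Q Z) (hcover : ∀ i, i ∈ P ∨ i ∈ Q ∨ i ∈ Z) (hfree : TentFree Ω P.card)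
    (c c' : ι) (hc : c ∈ P) (hc' : c' ∈ Q) :
    Real.exp ((meanLog Ω (Q ∪ Z) - meanLog Ω (insert c (Q ∪ Z))) -
        (meanLog Ω Z - meanLog Ω (insert c Z))) +
      Real.exp ((meanLog Ω (P ∪ Z) - meanLog Ω (insert c' (P ∪ Z))) -
        (meanLog Ω Z - meanLog Ω (insert c' Z))) ≤ 1 := by
  have hcZ : c ∉ Z := Finset.disjoint_left.1 hPZ hc
  have hc'Z : c' ∉ Z := Finset.disjoint_left.1 hQZ hc'
  refine (add_le_add (exp_meanLog_le Ω hΩ Z (Q ∪ Z) Finset.subset_union_right c)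
    (exp_meanLog_le Ω hΩ Z (P ∪ Z) Finset.subset_union_right c')).trans ?_
  have hN : (0 : ℝ) < Ω.card := by exact_mod_cast hΩ.card_pos
  rw [← add_div, div_le_one hN, ← Finset.sum_add_distrib]
  refine (Finset.sum_le_card_nsmul Ω _ 1 fun f hf => ?_).trans (by simp)
  rw [← add_div, div_le_one (card_agreeing_pos Z hf),
    card_agreeing_filter_swap h Z c c' hcZ hc'Z]
  norm_cast
  rw [← Finset.card_union_of_disjoint]
  · exact Finset.card_le_card (Finset.union_subset (Finset.filter_subset _ _)
      (Finset.filter_subset _ _))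
  · rw [Finset.disjoint_left]
    intro a ha ha'
    obtain ⟨g, hg, hgc⟩ := Finset.mem_image.1 (Finset.mem_filter.1 ha).2
    obtain ⟨g', hg', hgc'⟩ := Finset.mem_image.1 (Finset.mem_filter.1 ha').2
    rw [mem_agreeing] at hg hg'
    refine hfree f hf g hg.1 g' hg'.1 P rfl c hc c' (Finset.disjoint_right.1 hPQ hc') ?_ ?_
      (hgc.trans hgc'.symm)
    · intro i hi
      refine hg.2 i (Finset.mem_union.2 ?_)
      have := hcover i
      tauto
    · exact fun i hi => hg'.2 i (Finset.mem_union_left _ hi)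

end Entropy

/-! ### From entropy to the density bound. -/

/-- The first `m` coordinates. -/
def initialCoords (k m : ℕ) : Finset (Fin k) := Finset.univ.filter fun i => (i : ℕ) < m

theorem card_initialCoords {k m : ℕ} (h : m ≤ k) : (initialCoords k m).card = m := by
  rw [initialCoords, Fin.card_filter_val_lt]
  omega

section Bound

variable {V : Type*} [DecidableEq V] {k : ℕ}

theorem meanLog_eq_initialCoords {Ω : Finset (Fin k → V)} (h : PermClosed Ω) (I : Finset (Fin k))
    (m : ℕ) (hI : I.card = m) : meanLog Ω I = meanLog Ω (initialCoords k m) := by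
  refine meanLog_eq_of_card_eq h ?_
  rw [card_initialCoords, hI]
  rw [← hI]
  simpa using Finset.card_le_univ I

/-- By symmetry only sizes matter: `Z` is the first `k - (s + j)` coordinates, `Q` the next `j`, `P`
the last `s`. -/
theorem exp_initialCoords_add_le {Ω : Finset (Fin k → V)} (hΩ : Ω.Nonempty)
    (h : PermClosed Ω) (s j : ℕ) (hs : 1 ≤ s) (hj : 1 ≤ j) (hsj : s + j ≤ k)
    (hfree : TentFree Ω s) (L : ℕ → ℝ) (hL : ∀ m, L m = meanLog Ω (initialCoords k m)) :
    Real.exp (L (k - s) - L (k - s + 1)) + Real.exp (L (k - j) - L (k - j + 1)) ≤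
      Real.exp (L (k - (s + j)) - L (k - (s + j) + 1)) := by
  have hI : ∀ (I : Finset (Fin k)) (m : ℕ), I.card = m → meanLog Ω I = L m := fun I m hIm => by
    rw [hL, meanLog_eq_initialCoords h I m hIm]
  set Z : Finset (Fin k) := initialCoords k (k - (s + j)) with hZ
  set Q : Finset (Fin k) := initialCoords k (k - s) \ Z with hQ
  set P : Finset (Fin k) := Finset.univ \ initialCoords k (k - s) with hP
  have hZc : Z.card = k - (s + j) := card_initialCoords (by omega)
  have hsub : Z ⊆ initialCoords k (k - s) := by
    intro i
    simp only [hZ, initialCoords, Finset.mem_filter, Finset.mem_univ, true_and]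
    omega
  have hQc : Q.card = j := by
    rw [hQ, Finset.card_sdiff_of_subset hsub, hZc, card_initialCoords (by omega)]
    omega
  have hPc : P.card = s := by
    rw [hP, Finset.card_sdiff_of_subset (Finset.subset_univ _), card_initialCoords (by omega)]
    simp
    omega
  have hQZ : Disjoint Q Z := Finset.sdiff_disjoint
  have hPI : Disjoint P (initialCoords k (k - s)) := Finset.sdiff_disjoint
  have hPQ : Disjoint P Q := hPI.mono_right Finset.sdiff_subset
  have hPZ : Disjoint P Z := hPI.mono_right hsub
  obtain ⟨c, hc⟩ : P.Nonempty := Finset.card_pos.1 (by omega)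
  obtain ⟨c', hc'⟩ : Q.Nonempty := Finset.card_pos.1 (by omega)
  have hcQ : c ∉ Q ∪ Z := by
    rw [Finset.mem_union, not_or]
    exact ⟨Finset.disjoint_left.1 hPQ hc, Finset.disjoint_left.1 hPZ hc⟩
  have hcP : c' ∉ P ∪ Z := by
    rw [Finset.mem_union, not_or]
    exact ⟨Finset.disjoint_right.1 hPQ hc', Finset.disjoint_left.1 hQZ hc'⟩
  have h1 : (Q ∪ Z).card = k - s := by
    rw [Finset.card_union_of_disjoint hQZ, hQc, hZc]; omega
  have h2 : (P ∪ Z).card = k - j := by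
    rw [Finset.card_union_of_disjoint hPZ, hPc, hZc]; omega
  have key := exp_meanLog_add_exp_meanLog_le hΩ h P Q Z hPQ hPZ hQZ
    (fun i => by simp only [hP, hQ, Finset.mem_sdiff, Finset.mem_univ, true_and]; tauto)
    (hPc ▸ hfree) c c' hc hc'
  rw [hI _ _ h1, hI _ _ h2, hI _ _ hZc,
    hI (insert c (Q ∪ Z)) (k - s + 1) (by rw [Finset.card_insert_of_notMem hcQ, h1]),
    hI (insert c' (P ∪ Z)) (k - j + 1) (by rw [Finset.card_insert_of_notMem hcP, h2]),
    hI (insert c Z) (k - (s + j) + 1) (by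
      rw [Finset.card_insert_of_notMem (Finset.disjoint_left.1 hPZ hc), hZc]),
    hI (insert c' Z) (k - (s + j) + 1) (by
      rw [Finset.card_insert_of_notMem (Finset.disjoint_left.1 hQZ hc'), hZc]),
    Real.exp_sub _ (L (k - (s + j)) - L (k - (s + j) + 1)),
    Real.exp_sub _ (L (k - (s + j)) - L (k - (s + j) + 1)), ← add_div,
    div_le_one (Real.exp_pos _)] at key
  exact key

/-- This is `H(X_c) ≤ log |V|`: the ratios on each nonempty fibre of `f ↦ f c` add up to `#Ω`. -/
theorem exp_meanLog_empty_sub_le [Fintype V] {Ω : Finset (Fin k → V)} (hΩ : Ω.Nonempty)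
    (c : Fin k) :
    Real.exp (meanLog Ω ∅ - meanLog Ω {c}) ≤ Fintype.card V := by
  have hN : (0 : ℝ) < Ω.card := by exact_mod_cast hΩ.card_pos
  refine le_trans (le_of_eq ?_) ((exp_mean_log_le_mean Ω
    (fun f => (Ω.card : ℝ) / (agreeing Ω {c} f).card) ?_ hΩ).trans ?_)
  · congr 1
    simp only [meanLog]
    rw [← sub_div, ← Finset.sum_sub_distrib]
    congr 1
    refine Finset.sum_congr rfl fun f hf => ?_
    rw [Real.log_div hN.ne' (card_agreeing_pos {c} hf).ne']
    simp [agreeing]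
  · exact fun f hf => div_pos hN (card_agreeing_pos {c} hf)
  · rw [div_le_iff₀ hN, ← Finset.sum_fiberwise_of_maps_to (t := Finset.univ) (g := fun f => f c)
      (fun _ _ => Finset.mem_univ _)]
    refine (Finset.sum_le_card_nsmul _ _ (Ω.card : ℝ) fun v _ => ?_).trans (by simp)
    rcases (Ω.filter fun f => f c = v).eq_empty_or_nonempty with he | ⟨f₀, hf₀⟩
    · rw [he]; simp
    · have hag : ∀ f ∈ Ω.filter (fun f => f c = v),
          (Ω.card : ℝ) / (agreeing Ω {c} f).card = Ω.card / (Ω.filter fun f => f c = v).card := by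
        intro f hf
        congr 3
        ext g
        simp [mem_agreeing, (Finset.mem_filter.1 hf).2]
      rw [Finset.sum_congr rfl hag, Finset.sum_const, nsmul_eq_mul]
      have : (0 : ℝ) < (Ω.filter fun f => f c = v).card := by
        exact_mod_cast Finset.card_pos.2 ⟨f₀, hf₀⟩
      field_simp
      exact le_rfl

/-- The density bound for a symmetric set of tuples without homomorphic images of two-part
tents. -/
theorem card_le_of_tentFree [Fintype V] {Ω : Finset (Fin k → V)} (h : PermClosed Ω)
    (t : ℕ) (ht : 1 ≤ t) (hk : 1 ≤ k) (hfree : ∀ s, 1 ≤ s → s ≤ t → TentFree Ω s)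
    (hT : ∑ j ∈ Finset.Icc (t + 1) k, (1 : ℝ) / j ≤ 1) :
    (Ω.card : ℝ) ≤ (Fintype.card V : ℝ) ^ k * ((k ! : ℝ) / (k : ℝ) ^ k) := by
  rcases Ω.eq_empty_or_nonempty with rfl | hΩ
  · simp only [Finset.card_empty, Nat.cast_zero]
    positivity
  have hN : (0 : ℝ) < Ω.card := by exact_mod_cast hΩ.card_pos
  set L : ℕ → ℝ := fun m => meanLog Ω (initialCoords k m) with hL
  have hL0 : L 0 = Real.log Ω.card := by
    simp only [hL, initialCoords, meanLog, agreeing]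
    simp
    field_simp
  have hLk : L k = 0 := by
    have : ∀ f ∈ Ω, agreeing Ω (initialCoords k k) f = {f} := by
      intro f hf
      ext g
      simp only [mem_agreeing, initialCoords, Fin.is_lt, Finset.filter_true, Finset.mem_univ,
        true_imp_iff, Finset.mem_singleton]
      exact ⟨fun hg => funext hg.2, fun hg => by subst hg; exact ⟨hf, fun _ => rfl⟩⟩
    simp only [hL, meanLog]
    rw [Finset.sum_congr rfl (g := fun _ => (0 : ℝ)) fun f hf => by rw [this f hf]; simp]
    simp
  have hL1 : Real.exp (L 0 - L 1) ≤ Fintype.card V := by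
    have := exp_meanLog_empty_sub_le hΩ (⟨0, hk⟩ : Fin k)
    rwa [meanLog_eq_initialCoords h ∅ 0 (by simp), meanLog_eq_initialCoords h {_} 1 (by simp)]
      at this
  -- The value at `0` is imposed; the formula would give a positive number there.
  set x : ℕ → ℝ := fun i => if i = 0 then 0 else
    Real.exp (L (k - i) - L (k - i + 1)) / Real.exp (L 0 - L 1) with hx
  have hprod : ∏ j ∈ Finset.Icc 1 k, x j = Ω.card / Real.exp (L 0 - L 1) ^ k := by
    -- The chain rule: after reflecting the index the exponents telescope.
    have h1 : ∏ j ∈ Finset.Icc 1 k, x j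
        = ∏ m ∈ Finset.range k, (Real.exp (L m - L (m + 1)) / Real.exp (L 0 - L 1)) := by
      refine Finset.prod_nbij' (fun j => k - j) (fun m => k - m) ?_ ?_ ?_ ?_ ?_ <;>
        simp only [Finset.mem_Icc, Finset.mem_range] <;> intro a ha <;> try omega
      simp only [hx]
      rw [if_neg (by omega)]
    rw [h1, Finset.prod_div_distrib, ← Real.exp_sum, Finset.sum_range_sub', hL0, hLk, sub_zero,
      Real.exp_log hN]
    simp
  have hbound := prod_le_factorial_div_pow x k t ht hk (by simp [hx])
    (by simp [hx]; omega)
    (fun j => by simp only [hx]; split_ifs <;> positivity)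
    (fun i j hi hit hij => by
      rcases Nat.eq_zero_or_pos j with rfl | hj
      · simp [hx]
      · simp only [hx]
        rw [if_neg (by omega), if_neg (by omega), if_neg (by omega), ← add_div]
        exact div_le_div_of_nonneg_right
          (exp_initialCoords_add_le hΩ h i j hi hj hij (hfree i hi hit) L fun _ => rfl)
          (Real.exp_pos _).le) hT
  rw [hprod, div_le_iff₀ (by positivity)] at hbound
  refine hbound.trans ?_
  rw [mul_comm]
  exact mul_le_mul_of_nonneg_right (pow_le_pow_left₀ (Real.exp_pos _).le hL1 k) (by positivity)

end Bound

/-! ### Cleaning to an extendable graph, and its ordered edges. -/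

section Cleaning

variable {V : Type*} [DecidableEq V]

/-- Every subset of an edge extends to an edge avoiding any prescribed set of at most `M` further
vertices. -/
def Extendable (E : Finset (Finset V)) (M : ℕ) : Prop :=
  ∀ e ∈ E, ∀ S ⊆ e, ∀ B : Finset V, B.card ≤ M → ∃ e' ∈ E, S ⊆ e' ∧ e' ∩ B ⊆ S

variable [Fintype V]

theorem card_filter_superset_le (E : Finset (Finset V)) (k : ℕ) (hE : ∀ e ∈ E, e.card = k)
    (T : Finset V) :
    (E.filter fun e => T ⊆ e).card ≤ Fintype.card V ^ (k - T.card) := by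
  calc (E.filter fun e => T ⊆ e).card
      ≤ (Finset.powersetCard (k - T.card) (Finset.univ : Finset V)).card := by
        refine Finset.card_le_card_of_injOn (fun e => e \ T) ?_ ?_
        · intro e he
          have he := Finset.mem_filter.1 he
          simp only [Finset.mem_coe, Finset.mem_powersetCard, Finset.subset_univ, true_and]
          rw [Finset.card_sdiff_of_subset he.2, hE e he.1]
        · intro e he e' he' h
          have he := Finset.mem_filter.1 he
          have he' := Finset.mem_filter.1 he'
          rw [← Finset.sdiff_union_of_subset he.2, ← Finset.sdiff_union_of_subset he'.2]
          simp only at h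
          rw [h]
    _ ≤ Fintype.card V ^ (k - T.card) := by
        rw [Finset.card_powersetCard, Finset.card_univ]
        exact Nat.choose_le_pow _ _

/-- The sets of fewer than `k` vertices contained in an edge. -/
def lowerSets (E : Finset (Finset V)) (k : ℕ) : Finset (Finset V) :=
  Finset.univ.filter fun S => S.card < k ∧ ∃ e ∈ E, S ⊆ e

/-- Potential argument: while some `S` fails to extend, delete all edges containing it. Their number
is at most the charge of `S`, and `S` then leaves `lowerSets`, so each charge is paid once. -/
theorem exists_extendable_add_sum_le (k M : ℕ) (E : Finset (Finset V))
    (hE : ∀ e ∈ E, e.card = k) :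
    ∃ E' ⊆ E, Extendable E' M ∧
      E.card + ∑ S ∈ lowerSets E' k, M * Fintype.card V ^ (k - 1 - S.card) ≤
        E'.card + ∑ S ∈ lowerSets E k, M * Fintype.card V ^ (k - 1 - S.card) := by
  induction h : E.card using Nat.strong_induction_on generalizing E with
  | _ N ih =>
    subst h
    by_cases hext : Extendable E M
    · exact ⟨E, Finset.Subset.refl _, hext, le_rfl⟩
    · simp only [Extendable] at hext
      push Not at hext
      obtain ⟨e, he, S, hSe, B, hB, hno⟩ := hext
      have hSk : S.card < k := by
        rw [← hE e he]
        refine Finset.card_lt_card (hSe.ssubset_of_ne ?_)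
        rintro rfl
        exact hno S he (Finset.Subset.refl _) Finset.inter_subset_left
      have hsub : E.filter (fun e => ¬ S ⊆ e) ⊆ E := Finset.filter_subset _ _
      have hsplit : (E.filter fun e => S ⊆ e).card + (E.filter fun e => ¬ S ⊆ e).card = E.card :=
        Finset.card_filter_add_card_filter_not _
      have hpos : 0 < (E.filter fun e => S ⊆ e).card :=
        Finset.card_pos.2 ⟨e, Finset.mem_filter.2 ⟨he, hSe⟩⟩
      -- Since `S` cannot be extended off `B`, every edge containing `S` meets `B \ S`.
      have hdeg : (E.filter fun e => S ⊆ e).card ≤ M * Fintype.card V ^ (k - 1 - S.card) := by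
        have hcov : (E.filter fun e => S ⊆ e) ⊆
            (B \ S).biUnion fun b => E.filter fun e => insert b S ⊆ e := by
          intro a ha
          rw [Finset.mem_filter] at ha
          obtain ⟨b, hb, hbS⟩ := Finset.not_subset.1 (hno a ha.1 ha.2)
          rw [Finset.mem_inter] at hb
          simp only [Finset.mem_biUnion, Finset.mem_filter, Finset.mem_sdiff]
          exact ⟨b, ⟨hb.2, hbS⟩, ha.1, Finset.insert_subset hb.1 ha.2⟩
        refine (Finset.card_le_card hcov).trans ((Finset.card_biUnion_le_card_mul _ _
          (Fintype.card V ^ (k - 1 - S.card)) fun b hb => ?_).trans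
          (Nat.mul_le_mul_right _ ((Finset.card_le_card Finset.sdiff_subset).trans hB)))
        have := card_filter_superset_le E k hE (insert b S)
        rwa [Finset.card_insert_of_notMem (Finset.mem_sdiff.1 hb).2,
          show k - (S.card + 1) = k - 1 - S.card by omega] at this
      obtain ⟨E', hE', hE'ext, hle⟩ := ih _ (by omega) (E.filter fun e => ¬ S ⊆ e)
        (fun a ha => hE a (hsub ha)) rfl
      refine ⟨E', hE'.trans hsub, hE'ext, ?_⟩
      have hlow : insert S (lowerSets (E.filter fun e => ¬ S ⊆ e) k) ⊆ lowerSets E k := by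
        intro U hU
        simp only [lowerSets, Finset.mem_insert, Finset.mem_filter, Finset.mem_univ,
          true_and] at hU ⊢
        rcases hU with rfl | ⟨h1, a, ha, hUa⟩
        · exact ⟨hSk, e, he, hSe⟩
        · exact ⟨h1, a, ha.1, hUa⟩
      have hnot : S ∉ lowerSets (E.filter fun e => ¬ S ⊆ e) k := by
        simp only [lowerSets, Finset.mem_filter, Finset.mem_univ, true_and, not_and, not_exists]
        exact fun _ a ha hSa => ha.2 hSa
      have hsum := Finset.sum_le_sum_of_subset (f := fun S : Finset V =>
        M * Fintype.card V ^ (k - 1 - S.card)) hlow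
      rw [Finset.sum_insert hnot] at hsum
      omega

/-- For each size `s < k` there are at most `n^s` sets, each charged `M n^(k-1-s)`. -/
theorem sum_lowerSets_le (E : Finset (Finset V)) (k M : ℕ) :
    ∑ S ∈ lowerSets E k, M * Fintype.card V ^ (k - 1 - S.card) ≤
      k * M * Fintype.card V ^ (k - 1) := by
  rw [← Finset.sum_fiberwise_of_maps_to (t := Finset.range k) (g := Finset.card)
    (fun S hS => Finset.mem_range.2 (Finset.mem_filter.1 hS).2.1)]
  refine (Finset.sum_le_card_nsmul _ _ (M * Fintype.card V ^ (k - 1)) fun s hs => ?_).trans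
    (by simp [mul_assoc])
  rw [Finset.mem_range] at hs
  calc _ = ((lowerSets E k).filter fun S => S.card = s).card *
        (M * Fintype.card V ^ (k - 1 - s)) := by
        rw [Finset.sum_congr rfl (g := fun _ => M * Fintype.card V ^ (k - 1 - s))
          fun S hS => by rw [(Finset.mem_filter.1 hS).2], Finset.sum_const, smul_eq_mul]
    _ ≤ Fintype.card V ^ s * (M * Fintype.card V ^ (k - 1 - s)) := by
        refine Nat.mul_le_mul_right _ ((Finset.card_le_card (t :=
          Finset.powersetCard s Finset.univ) fun S hS => ?_).trans ?_)
        · exact Finset.mem_powersetCard.2 ⟨Finset.subset_univ _, (Finset.mem_filter.1 hS).2⟩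
        · rw [Finset.card_powersetCard, Finset.card_univ]
          exact Nat.choose_le_pow _ _
    _ = M * Fintype.card V ^ (k - 1) := by
        rw [mul_left_comm, ← pow_add, show s + (k - 1 - s) = k - 1 by omega]

/-- Deleting `O(n ^ (k - 1))` edges makes a `k`-graph extendable. -/
theorem exists_extendable_card_le (k M : ℕ) (E : Finset (Finset V))
    (hE : ∀ e ∈ E, e.card = k) :
    ∃ E' ⊆ E, Extendable E' M ∧ E.card ≤ E'.card + k * M * Fintype.card V ^ (k - 1) := by
  obtain ⟨E', h1, h2, h3⟩ := exists_extendable_add_sum_le k M E hE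
  have := sum_lowerSets_le E k M
  exact ⟨E', h1, h2, by omega⟩

/-- The injective enumerations of the edges in `E`. -/
def edgeTuples (E : Finset (Finset V)) (k : ℕ) : Finset (Fin k → V) :=
  E.biUnion fun e => Finset.univ.filter fun f => Function.Injective f ∧ Finset.univ.image f = e

theorem mem_edgeTuples {E : Finset (Finset V)} {k : ℕ} {f : Fin k → V} :
    f ∈ edgeTuples E k ↔ Function.Injective f ∧ Finset.univ.image f ∈ E := by
  simp [edgeTuples, and_comm]

theorem permClosed_edgeTuples (E : Finset (Finset V)) (k : ℕ) : PermClosed (edgeTuples E k) := by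
  intro f hf σ
  rw [mem_edgeTuples] at hf ⊢
  refine ⟨hf.1.comp σ.injective, ?_⟩
  rw [← Finset.image_image, Finset.image_univ_equiv]
  exact hf.2

theorem card_enumerations (k : ℕ) (e : Finset V) (he : e.card = k) :
    (Finset.univ.filter fun f : Fin k → V =>
      Function.Injective f ∧ Finset.univ.image f = e).card = k ! := by
  have hcard : Fintype.card (Fin k) = Fintype.card e := by simp [he]
  have h1 : Fintype.card (Fin k ≃ e) = k ! := by
    rw [Fintype.card_equiv (Fintype.equivOfCardEq hcard), Fintype.card_fin]
  rw [← h1, ← Finset.card_univ]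
  symm
  refine Finset.card_bij (fun u _ i => (u i : V)) ?_ ?_ ?_
  · intro u _
    simp only [Finset.mem_filter, Finset.mem_univ, true_and]
    refine ⟨Subtype.val_injective.comp u.injective, ?_⟩
    ext v
    simp only [Finset.mem_image, Finset.mem_univ, true_and]
    constructor
    · rintro ⟨i, rfl⟩; exact (u i).2
    · exact fun hv => ⟨u.symm ⟨v, hv⟩, by simp⟩
  · intro u _ ψ _ h
    ext i
    exact congrFun h i
  · intro f hf
    simp only [Finset.mem_filter, Finset.mem_univ, true_and] at hf
    have hmem : ∀ i, f i ∈ e := fun i => hf.2 ▸ Finset.mem_image_of_mem f (Finset.mem_univ i)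
    refine ⟨Equiv.ofBijective (fun i => (⟨f i, hmem i⟩ : e)) ?_, Finset.mem_univ _, rfl⟩
    rw [Fintype.bijective_iff_injective_and_card]
    exact ⟨fun i j hij => hf.1 (congrArg Subtype.val hij), hcard⟩

theorem card_edgeTuples (E : Finset (Finset V)) (k : ℕ) (hE : ∀ e ∈ E, e.card = k) :
    (edgeTuples E k).card = E.card * k ! := by
  rw [edgeTuples, Finset.card_biUnion]
  · rw [Finset.sum_congr rfl fun e he => card_enumerations k e (hE e he), Finset.sum_const,
      smul_eq_mul]
  · intro e _ e' _ hne
    rw [Function.onFun, Finset.disjoint_left]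
    intro f hf hf'
    exact hne ((Finset.mem_filter.1 hf).2.2.symm.trans (Finset.mem_filter.1 hf').2.2)

end Cleaning

/-! ### Embedding a genuine tent. -/

section Embedding

variable {V : Type*} [DecidableEq V]

/-- Greedy choice: each new arm extends `T a` while avoiding, outside `T a`, the base and all
earlier arms. -/
theorem exists_arms {ℓ k M : ℕ} {E : Finset (Finset V)} (hE : ∀ e ∈ E, e.card = k)
    (hext : Extendable E M) (base : Finset V) (hM : base.card + ℓ * k ≤ M)
    (T : Fin ℓ → Finset V) (hT : ∀ i, ∃ e ∈ E, T i ⊆ e) (s : Finset (Fin ℓ)) :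
    ∃ arm : Fin ℓ → Finset V,
      (∀ i ∈ s, arm i ∈ E ∧ T i ⊆ arm i ∧ arm i ∩ base ⊆ T i) ∧
      ∀ i ∈ s, ∀ j ∈ s, i ≠ j → arm i ∩ arm j ⊆ T i ∪ T j := by
  induction s using Finset.induction_on with
  | empty => exact ⟨fun _ => ∅, by simp, by simp⟩
  | insert a s ha ih =>
    obtain ⟨arm, h1, h2⟩ := ih
    obtain ⟨e, he, hTe⟩ := hT a
    have hcard : (base ∪ s.biUnion arm).card ≤ M := by
      refine (Finset.card_union_le _ _).trans (le_trans (Nat.add_le_add_left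
        ((Finset.card_biUnion_le_card_mul s arm k fun i hi => (hE _ (h1 i hi).1).le).trans
          (Nat.mul_le_mul_right k ?_)) _) hM)
      simpa using Finset.card_le_univ s
    obtain ⟨e', he', hTe', hdis⟩ := hext e he (T a) hTe _ hcard
    have hne : ∀ i ∈ s, i ≠ a := fun i hi h => ha (h ▸ hi)
    have harm : ∀ i ∈ s, e' ∩ arm i ⊆ T a := fun i hi x hx => by
      rw [Finset.mem_inter] at hx
      exact hdis (Finset.mem_inter.2 ⟨hx.1,
        Finset.mem_union_right _ (Finset.mem_biUnion.2 ⟨i, hi, hx.2⟩)⟩)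
    refine ⟨Function.update arm a e', ?_, ?_⟩
    · intro i hi
      rcases Finset.mem_insert.1 hi with rfl | hi
      · rw [Function.update_self]
        refine ⟨he', hTe', fun x hx => ?_⟩
        rw [Finset.mem_inter] at hx
        exact hdis (Finset.mem_inter.2 ⟨hx.1, Finset.mem_union_left _ hx.2⟩)
      · rw [Function.update_of_ne (hne i hi)]
        exact h1 i hi
    · intro i hi j hj hij
      rw [Finset.mem_insert] at hi hj
      rcases hi with hia | hi <;> rcases hj with hja | hj
      · exact absurd (hia.trans hja.symm) hij
      · rw [hia, Function.update_self, Function.update_of_ne (hne j hj)]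
        exact (harm j hj).trans Finset.subset_union_left
      · rw [hja, Function.update_self, Function.update_of_ne (hne i hi), Finset.inter_comm]
        exact (harm i hi).trans Finset.subset_union_right
      · rw [Function.update_of_ne (hne i hi), Function.update_of_ne (hne j hj)]
        exact h2 i hi j hj hij

/-- Listing `Y` first matches the convention of `tentBase`, where the base takes an initial segment
of each arm. -/
theorem exists_enumeration (m : ℕ) (X Y : Finset V) (hYX : Y ⊆ X) (hX : X.card = m) :
    ∃ u : Fin m → V, Function.Injective u ∧ (∀ x, x ∈ X ↔ ∃ j, u j = x) ∧
      ∀ j, u j ∈ Y ↔ (j : ℕ) < Y.card := by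
  let e₀ : Fin m ≃ X := Fintype.equivOfCardEq (by simp [hX])
  have hcard : (initialCoords m Y.card).card
      = (Finset.univ.filter fun j => (e₀ j : V) ∈ Y).card := by
    rw [card_initialCoords (hX ▸ Finset.card_le_card hYX)]
    symm
    refine Finset.card_bij (fun j _ => (e₀ j : V)) ?_ ?_ ?_
    · intro j hj
      exact (Finset.mem_filter.1 hj).2
    · intro i _ j _ h
      exact e₀.injective (Subtype.ext h)
    · intro y hy
      exact ⟨e₀.symm ⟨y, hYX hy⟩, by simp [hy], by simp⟩
  obtain ⟨σ, hσ⟩ := Equiv.Perm.exists_map_finset_eq _ _ hcard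
  refine ⟨fun j => e₀ (σ j), fun i j h => σ.injective (e₀.injective (Subtype.ext h)), ?_, ?_⟩
  · intro x
    constructor
    · exact fun hx => ⟨σ.symm (e₀.symm ⟨x, hx⟩), by simp⟩
    · rintro ⟨j, rfl⟩
      exact (e₀ (σ j)).2
  · intro j
    have h1 : σ j ∈ Finset.univ.filter (fun j => (e₀ j : V) ∈ Y) ↔ (e₀ (σ j) : V) ∈ Y := by simp
    rw [← h1, ← hσ]
    simp [initialCoords]

/-- Cuts the coordinates into the parts of `lam` so that `S` is the union of the blocks in `A`; this
is how a two-part tent is refined. -/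
theorem exists_blocks {ℓ k : ℕ} (lam : Fin ℓ → ℕ) (hsum : ∑ i, lam i = k) (A : Finset (Fin ℓ))
    (S : Finset (Fin k)) (hS : S.card = ∑ i ∈ A, lam i) :
    ∃ b : Fin k → Fin ℓ, (∀ i, (Finset.univ.filter fun x => b x = i).card = lam i) ∧
      ∀ x, b x ∈ A ↔ x ∈ S := by
  let e₀ : Fin k ≃ (Σ i : Fin ℓ, Fin (lam i)) := Fintype.equivOfCardEq (by simp [hsum])
  have hfib : ∀ i, (Finset.univ.filter fun x => (e₀ x).1 = i).card = lam i := by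
    intro i
    rw [← Fintype.card_fin (lam i), ← Finset.card_univ]
    symm
    refine Finset.card_bij (fun j _ => e₀.symm ⟨i, j⟩) ?_ ?_ ?_
    · intro j _
      simp
    · intro j _ j' _ h
      simpa using h
    · intro x hx
      obtain ⟨-, rfl⟩ := Finset.mem_filter.1 hx
      exact ⟨(e₀ x).2, Finset.mem_univ _, by simp⟩
  have hcard : S.card = (Finset.univ.filter fun x => (e₀ x).1 ∈ A).card := by
    have hmaps : ∀ x ∈ Finset.univ.filter fun x => (e₀ x).1 ∈ A, (e₀ x).1 ∈ A :=
      fun x hx => (Finset.mem_filter.1 hx).2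
    rw [hS, Finset.card_eq_sum_card_fiberwise hmaps]
    refine Finset.sum_congr rfl fun i hi => ?_
    rw [← hfib i, Finset.filter_filter]
    congr 1
    ext x
    simp only [Finset.mem_filter, Finset.mem_univ, true_and]
    constructor
    · rintro rfl; exact ⟨hi, rfl⟩
    · exact fun h => h.2
  obtain ⟨σ, hσ⟩ := Equiv.Perm.exists_map_finset_eq _ _ hcard
  refine ⟨fun x => (e₀ (σ x)).1, fun i => ?_, fun x => ?_⟩
  · rw [← hfib i]
    refine Finset.card_bij (fun x _ => σ x) ?_ ?_ ?_
    · intro x hx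
      simpa using hx
    · intro x _ y _ h
      exact σ.injective h
    · intro x hx
      exact ⟨σ.symm x, by simpa using hx, by simp⟩
  · have h1 : σ x ∈ Finset.univ.filter (fun x => (e₀ x).1 ∈ A) ↔ (e₀ (σ x)).1 ∈ A := by simp
    rw [← h1, ← hσ]
    simp

/-- A homomorphic image of a two-part tent in an extendable `k`-graph yields a genuine copy of any
tent refining it. -/
theorem contains_tent_of_extendable [Fintype V] {ℓ k : ℕ} (lam : Fin ℓ → ℕ)
    (hsum : ∑ i, lam i = k) {E : Finset (Finset V)} (hE : ∀ e ∈ E, e.card = k)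
    (hext : Extendable E (k + ℓ * k)) (G : Hypergraph V) (hGv : G.vertexSet = Set.univ)
    (hGE : ∀ e ∈ E, (e : Set V) ∈ G.edgeSet) (A : Finset (Fin ℓ))
    (hnot : ¬ TentFree (edgeTuples E k) (∑ i ∈ A, lam i)) :
    G.Contains (Hypergraph.tent k lam) := by
  simp only [TentFree] at hnot
  push Not at hnot
  obtain ⟨f, hf, g, hg, g', hg', S, hS, c, hc, c', hc', hgf, hg'f, hv⟩ := hnot
  rw [mem_edgeTuples] at hf hg hg'
  obtain ⟨b, hb, hbA⟩ := exists_blocks lam hsum A S hS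
  set v := g c with hvdef
  set base := Finset.univ.image f with hbase
  -- The apex is off the base: on `S` compare with the injective `g'`, off `S` with `g`.
  have hvf : ∀ x, f x ≠ v := by
    intro x hx
    by_cases hxS : x ∈ S
    · rw [hv, ← hg'f x hxS] at hx
      exact hc' (hg'.1 hx ▸ hxS)
    · rw [hvdef, ← hgf x hxS] at hx
      exact hxS (hg.1 hx ▸ hc)
  set Y : Fin ℓ → Finset V := fun i => (Finset.univ.filter fun x => b x = i).image f with hY
  have hYmem : ∀ i y, y ∈ Y i ↔ ∃ x, b x = i ∧ f x = y := fun i y => by simp [hY]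
  have hvY : ∀ i, v ∉ Y i := fun i h => by
    obtain ⟨x, -, hx⟩ := (hYmem i v).1 h
    exact hvf x hx
  have hYcard : ∀ i, (Y i).card = lam i := fun i => by
    rw [hY, Finset.card_image_of_injective _ hf.1, hb]
  have hYbase : ∀ i, Y i ⊆ base := fun i => Finset.image_subset_image (Finset.filter_subset _ _)
  have hYdisj : ∀ i j y, y ∈ Y i → y ∈ Y j → i = j := by
    intro i j y hi hj
    obtain ⟨x, hx, hxy⟩ := (hYmem i y).1 hi
    obtain ⟨x', hx', hxy'⟩ := (hYmem j y).1 hj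
    rw [← hx, ← hx', hf.1 (hxy.trans hxy'.symm)]
  -- Blocks in `A` lie with the apex in the edge of `g'`, the others in the edge of `g`.
  have hTsub : ∀ i, ∃ e ∈ E, insert v (Y i) ⊆ e := by
    intro i
    by_cases hi : i ∈ A
    · refine ⟨_, hg'.2, Finset.insert_subset ?_ ?_⟩
      · rw [hv]; exact Finset.mem_image_of_mem _ (Finset.mem_univ _)
      · intro y hy
        obtain ⟨x, hx, rfl⟩ := (hYmem i y).1 hy
        rw [← hg'f x ((hbA x).1 (hx ▸ hi))]
        exact Finset.mem_image_of_mem _ (Finset.mem_univ _)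
    · refine ⟨_, hg.2, Finset.insert_subset ?_ ?_⟩
      · exact Finset.mem_image_of_mem _ (Finset.mem_univ _)
      · intro y hy
        obtain ⟨x, hx, rfl⟩ := (hYmem i y).1 hy
        rw [← hgf x fun hxS => hi (hx ▸ (hbA x).2 hxS)]
        exact Finset.mem_image_of_mem _ (Finset.mem_univ _)
  obtain ⟨arm, harm, harm2⟩ := exists_arms hE hext base (by rw [hE _ hf.2])
    (fun i => insert v (Y i)) hTsub Finset.univ
  have hvarm : ∀ i, v ∈ arm i := fun i =>
    (harm i (Finset.mem_univ i)).2.1 (Finset.mem_insert_self _ _)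
  have henum : ∀ i, ∃ u : Fin (k - 1) → V, Function.Injective u ∧
      (∀ x, x ∈ (arm i).erase v ↔ ∃ j, u j = x) ∧ ∀ j, u j ∈ Y i ↔ (j : ℕ) < (Y i).card :=
    fun i => exists_enumeration (k - 1) _ _
      (fun y hy => Finset.mem_erase.2 ⟨fun h => hvY i (h ▸ hy),
        (harm i (Finset.mem_univ i)).2.1 (Finset.mem_insert_of_mem hy)⟩)
      (by rw [Finset.card_erase_of_mem (hvarm i), hE _ (harm i (Finset.mem_univ i)).1])
  choose u huinj hu huY using henum
  have humem : ∀ i j, u i j ≠ v ∧ u i j ∈ arm i := fun i j =>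
    Finset.mem_erase.1 ((hu i _).2 ⟨j, rfl⟩)
  have hsep : ∀ i j i' j', u i j = u i' j' → u i j ∈ Y i → i = i' := by
    intro i j i' j' h hy
    have h1 : u i j ∈ arm i' ∩ base :=
      Finset.mem_inter.2 ⟨h ▸ (humem i' j').2, hYbase i hy⟩
    have h2 := (harm i' (Finset.mem_univ _)).2.2 h1
    rcases Finset.mem_insert.1 h2 with h3 | h3
    · exact absurd h3 (humem i j).1
    · exact hYdisj i i' _ hy h3
  -- A vertex common to two arms is the apex or a base vertex in one block, and a base vertex lies
  -- only in the arm of its own block.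
  have hucross : ∀ i j i' j', u i j = u i' j' → i = i' := by
    intro i j i' j' h
    by_contra hne
    have h1 : u i j ∈ arm i ∩ arm i' :=
      Finset.mem_inter.2 ⟨(humem i j).2, h ▸ (humem i' j').2⟩
    have h2 := harm2 i (Finset.mem_univ _) i' (Finset.mem_univ _) hne h1
    rcases Finset.mem_union.1 h2 with h3 | h3 <;> rcases Finset.mem_insert.1 h3 with h4 | h4
    · exact (humem i j).1 h4
    · exact hne (hsep i j i' j' h h4)
    · exact (humem i j).1 h4
    · exact hne (hsep i' j' i j h.symm (h ▸ h4)).symm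
  let F : Option (Fin ℓ × Fin (k - 1)) → V := fun o => o.elim v fun p => u p.1 p.2
  refine ⟨F, ?_, ?_, ?_⟩
  · refine Function.Injective.injOn ?_
    rintro (_ | ⟨i, j⟩) (_ | ⟨i', j'⟩) h
    · rfl
    · exact absurd h.symm (humem i' j').1
    · exact absurd h (humem i j).1
    · have hii : i = i' := hucross i j i' j' h
      subst hii
      rw [huinj i (show u i j = u i j' from h)]
  · intro x _
    rw [hGv]
    trivial
  · rintro e (rfl | ⟨i, rfl⟩)
    · convert hGE _ hf.2
      ext y
      simp only [Hypergraph.tentBase, Set.mem_image, Set.mem_ofPred_eq, hbase, Finset.mem_coe,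
        Finset.mem_image, Finset.mem_univ, true_and]
      constructor
      · rintro ⟨_, ⟨i, j, rfl, hj⟩, rfl⟩
        have : u i j ∈ Y i := (huY i j).2 (by rwa [hYcard])
        obtain ⟨x, -, hx⟩ := (hYmem i _).1 this
        exact ⟨x, hx⟩
      · rintro ⟨x, rfl⟩
        have hy : f x ∈ Y (b x) := (hYmem _ _).2 ⟨x, rfl, rfl⟩
        obtain ⟨j, hj⟩ := (hu (b x) (f x)).1 (Finset.mem_erase.2 ⟨hvf x,
          (harm _ (Finset.mem_univ _)).2.1 (Finset.mem_insert_of_mem hy)⟩)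
        exact ⟨some (b x, j), ⟨b x, j, rfl, by rw [← hYcard, ← huY, hj]; exact hy⟩, hj⟩
    · convert hGE _ (harm i (Finset.mem_univ i)).1
      ext y
      simp only [Hypergraph.tentArm, Set.mem_image, Set.mem_ofPred_eq, Finset.mem_coe]
      constructor
      · rintro ⟨_, rfl | ⟨j, rfl⟩, rfl⟩
        · exact hvarm i
        · exact (humem i j).2
      · intro hy
        by_cases hyv : y = v
        · exact ⟨none, Or.inl rfl, hyv.symm⟩
        · obtain ⟨j, hj⟩ := (hu i y).1 (Finset.mem_erase.2 ⟨hyv, hy⟩)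
          exact ⟨some (i, j), Or.inr ⟨j, rfl⟩, hj⟩

end Embedding

/-! ### The threshold and the upper bound on the number of edges. -/

namespace Hypergraph

theorem one_le_tentThreshold {k : ℕ} (hk : 2 ≤ k) : 1 ≤ tentThreshold k := by
  refine Nat.le_findGreatest (by omega) ?_
  have hsub : ({1, 2} : Finset ℕ) ⊆ Finset.Icc 1 k := by
    intro a
    simp only [Finset.mem_insert, Finset.mem_singleton, Finset.mem_Icc]
    omega
  have h := Finset.sum_le_sum_of_subset_of_nonneg (f := fun i : ℕ => (1 : ℚ) / i) hsub
    fun _ _ _ => by positivity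
  refine lt_of_lt_of_le ?_ h
  norm_num

theorem sum_Icc_tentThreshold_le (k : ℕ) :
    ∑ j ∈ Finset.Icc (tentThreshold k + 1) k, (1 : ℝ) / j ≤ 1 := by
  by_cases h : tentThreshold k + 1 ≤ k
  · have h1 := Nat.findGreatest_is_greatest
      (P := fun s => 1 < ∑ i ∈ Finset.Icc s k, (1 : ℚ) / (i : ℚ)) (Nat.lt_succ_self _) h
    have h2 : ∑ j ∈ Finset.Icc (tentThreshold k + 1) k, (1 : ℚ) / j ≤ 1 := not_lt.1 h1
    have h3 := (Rat.cast_le (K := ℝ)).2 h2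
    push_cast at h3
    exact h3
  · rw [Finset.Icc_eq_empty h]
    simp

theorem tentThreshold_nine_le : tentThreshold 9 ≤ 3 := by
  by_contra! hcon
  have hspec : 1 < ∑ i ∈ Finset.Icc (tentThreshold 9) 9, (1 : ℚ) / (i : ℚ) :=
    Nat.findGreatest_of_ne_zero (P := fun s => 1 < ∑ i ∈ Finset.Icc s 9, (1 : ℚ) / (i : ℚ))
      rfl (by have := hcon; unfold tentThreshold at this; omega)
  have hsub : Finset.Icc (tentThreshold 9) 9 ⊆ Finset.Icc 4 9 :=
    Finset.Icc_subset_Icc_left hcon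
  have h := Finset.sum_le_sum_of_subset_of_nonneg (f := fun i : ℕ => (1 : ℚ) / i) hsub
    fun _ _ _ => by positivity
  have h9 : ∑ i ∈ Finset.Icc (4 : ℕ) 9, (1 : ℚ) / (i : ℚ) < 1 := by
    norm_num [Finset.sum_Icc_succ_top]
  linarith

theorem turanNumber_le {α : Type*} {k n m : ℕ} {𝓕 : Set (Hypergraph α)}
    (h : ∀ G : Hypergraph (Fin n), G.vertexSet = Set.univ → G.IsUniform k →
      (∀ F ∈ 𝓕, ¬ G.Contains F) → G.edgeSet.ncard ≤ m) : turanNumber k n 𝓕 ≤ m := by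
  refine csSup_le' ?_
  rintro _ ⟨G, h1, h2, h3, rfl⟩
  exact h G h1 h2 h3

theorem le_turanNumber {α : Type*} {k n : ℕ} {𝓕 : Set (Hypergraph α)} (G : Hypergraph (Fin n))
    (h1 : G.vertexSet = Set.univ) (h2 : G.IsUniform k) (h3 : ∀ F ∈ 𝓕, ¬ G.Contains F) :
    G.edgeSet.ncard ≤ turanNumber k n 𝓕 := by
  refine le_csSup ⟨Nat.card (Set (Fin n)), ?_⟩ ⟨G, h1, h2, h3, rfl⟩
  rintro _ ⟨G, -, -, -, rfl⟩
  exact Set.ncard_le_card _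

theorem exists_edgeFinset {n k : ℕ} (G : Hypergraph (Fin n)) (hG : G.IsUniform k) :
    ∃ E : Finset (Finset (Fin n)), (∀ e ∈ E, (e : Set (Fin n)) ∈ G.edgeSet) ∧
      (∀ e ∈ E, e.card = k) ∧ G.edgeSet.ncard = E.card := by
  classical
  refine ⟨Finset.univ.filter fun e => (e : Set (Fin n)) ∈ G.edgeSet, fun e he =>
    (Finset.mem_filter.1 he).2, fun e he => ?_, ?_⟩
  · have := hG _ (Finset.mem_filter.1 he).2
    rw [Set.encard_coe_eq_coe_finsetCard] at this
    exact_mod_cast this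
  · rw [← Set.ncard_coe_finset, ← Set.ncard_image_of_injective _ Finset.coe_injective]
    congr 1
    ext s
    simp only [Finset.coe_filter, Finset.mem_univ, true_and, Set.mem_image, Set.mem_ofPred_eq]
    constructor
    · exact fun hs => ⟨s.toFinset, by simpa using hs, by simp⟩
    · rintro ⟨e, he, rfl⟩
      exact he

theorem card_edgeSet_le_of_tent_free {n k t ℓ : ℕ} (lam : Fin ℓ → ℕ) (hsum : ∑ i, lam i = k)
    (ht : 1 ≤ t) (hk : 1 ≤ k) (hsub : Set.Icc 1 t ⊆ subsetSums lam)
    (hT : ∑ j ∈ Finset.Icc (t + 1) k, (1 : ℝ) / j ≤ 1)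
    (G : Hypergraph (Fin n)) (hGv : G.vertexSet = Set.univ) (hG : G.IsUniform k)
    (hfree : ¬ G.Contains (tent k lam)) :
    (G.edgeSet.ncard : ℝ) ≤ (n : ℝ) ^ k / (k : ℝ) ^ k +
      (k * (k + ℓ * k) : ℕ) * (n : ℝ) ^ (k - 1) := by
  obtain ⟨E, hEG, hE, hcard⟩ := exists_edgeFinset G hG
  obtain ⟨E', hE'E, hext, hle⟩ := exists_extendable_card_le k (k + ℓ * k) E hE
  have hE' : ∀ e ∈ E', e.card = k := fun e he => hE e (hE'E he)
  have hbound := card_le_of_tentFree (permClosed_edgeTuples E' k) t ht hk (fun s hs hst => by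
    obtain ⟨A, rfl⟩ := hsub ⟨hs, hst⟩
    by_contra hnot
    exact hfree (contains_tent_of_extendable lam hsum hE' hext G hGv
      (fun e he => hEG e (hE'E he)) A hnot)) hT
  rw [card_edgeTuples E' k hE', Fintype.card_fin] at hbound
  push_cast at hbound
  have hfac : (0 : ℝ) < (k ! : ℝ) := by positivity
  have h1 : (E'.card : ℝ) ≤ (n : ℝ) ^ k / (k : ℝ) ^ k := by
    refine le_of_mul_le_mul_right (hbound.trans (le_of_eq ?_)) hfac
    ring
  rw [Fintype.card_fin] at hle
  have h2 : (E.card : ℝ) ≤ E'.card + (k * (k + ℓ * k) : ℕ) * (n : ℝ) ^ (k - 1) := by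
    exact_mod_cast hle
  rw [hcard]
  linarith

/-! ### The complete `k`-partite lower bound. -/

/-- The complete `k`-partite `k`-graph on `n` vertices whose parts are the residue classes
modulo `k`. -/
def completePartite (n k : ℕ) : Hypergraph (Fin n) where
  vertexSet := Set.univ
  edgeSet := {e | e.encard = k ∧ ∀ x ∈ e, ∀ y ∈ e, (x : ℕ) % k = (y : ℕ) % k → x = y}
  subset_vertexSet_of_mem_edgeSet' := fun _ _ => Set.subset_univ _

theorem exists_residue_of_mem_edgeSet {n k : ℕ} (hk : 1 ≤ k) {e : Set (Fin n)}
    (he : e ∈ (completePartite n k).edgeSet) (r : ℕ) (hr : r < k) :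
    ∃ x ∈ e, (x : ℕ) % k = r := by
  classical
  obtain ⟨h1, h2⟩ := he
  have hc : e.toFinset.card = k := by
    rw [← Set.coe_toFinset e, Set.encard_coe_eq_coe_finsetCard] at h1
    exact_mod_cast h1
  have himg : e.toFinset.image (fun x : Fin n => (x : ℕ) % k) = Finset.range k := by
    refine Finset.eq_of_subset_of_card_le ?_ ?_
    · intro a ha
      obtain ⟨x, -, rfl⟩ := Finset.mem_image.1 ha
      exact Finset.mem_range.2 (Nat.mod_lt _ hk)
    · rw [Finset.card_image_of_injOn, hc, Finset.card_range]
      intro x hx y hy hxy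
      exact h2 x (by simpa using hx) y (by simpa using hy) hxy
  obtain ⟨x, hx, hxr⟩ := Finset.mem_image.1 (himg ▸ Finset.mem_range.2 hr)
  exact ⟨x, by simpa using hx, hxr⟩

theorem not_contains_tent_completePartite {n k ℓ : ℕ} (hk : 1 ≤ k) (lam : Fin ℓ → ℕ) :
    ¬ (completePartite n k).Contains (tent k lam) := by
  rintro ⟨F, hF, -, hedge⟩
  have hinj : Function.Injective F := Set.injOn_univ.1 hF
  obtain ⟨_, ⟨w, hw, rfl⟩, hwr⟩ := exists_residue_of_mem_edgeSet hk
    (hedge _ (Or.inl rfl)) ((F none : ℕ) % k) (Nat.mod_lt _ hk)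
  obtain ⟨i, j, rfl, -⟩ := hw
  have harm := hedge _ (Or.inr ⟨i, rfl⟩)
  have := harm.2 _ ⟨some (i, j), Or.inr ⟨j, rfl⟩, rfl⟩ _ ⟨none, Or.inl rfl, rfl⟩ hwr
  exact Option.some_ne_none _ (hinj this)

/-- Independent choices of `h i * k + i` in each residue class give distinct edges. -/
theorem div_pow_le_card_completePartite {n k : ℕ} (hk : 1 ≤ k) :
    (n / k) ^ k ≤ (completePartite n k).edgeSet.ncard := by
  have hlt : ∀ (h : Fin k → Fin (n / k)) (i : Fin k), (h i : ℕ) * k + i < n := by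
    intro h i
    have h1 : ((h i : ℕ) + 1) * k ≤ n / k * k := Nat.mul_le_mul_right k (h i).2
    have h2 := Nat.div_mul_le_self n k
    have h3 := i.2
    rw [add_mul] at h1
    omega
  let vtx : (Fin k → Fin (n / k)) → Fin k → Fin n := fun h i => ⟨(h i : ℕ) * k + i, hlt h i⟩
  have hmod : ∀ h i, ((vtx h i : Fin n) : ℕ) % k = i := fun h i => by
    simp only [vtx]
    rw [Nat.mul_add_mod_self_right, Nat.mod_eq_of_lt i.2]
  have hinj : Function.Injective fun h => Set.range (vtx h) := by
    intro h h' heq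
    funext i
    have hi : vtx h i ∈ Set.range (vtx h') := by
      have : vtx h i ∈ Set.range (vtx h) := ⟨i, rfl⟩
      simp only at heq
      rwa [heq] at this
    obtain ⟨i', hi'⟩ := hi
    have hii : i' = i := Fin.ext (by rw [← hmod h' i', ← hmod h i, hi'])
    subst hii
    have h1 : (h' i' : ℕ) * k + i' = (h i' : ℕ) * k + i' := congrArg Fin.val hi'
    exact Fin.ext (Nat.eq_of_mul_eq_mul_right hk (by omega)).symm
  have hsub : Set.range (fun h => Set.range (vtx h)) ⊆ (completePartite n k).edgeSet := by
    rintro _ ⟨h, rfl⟩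
    have hv : Function.Injective (vtx h) := fun i j hij =>
      Fin.ext (by rw [← hmod h i, ← hmod h j, hij])
    refine ⟨?_, ?_⟩
    · simp only
      rw [← Set.image_univ, hv.encard_image, Set.encard_univ]
      simp
    · rintro _ ⟨i, rfl⟩ _ ⟨j, rfl⟩ hij
      rw [hmod, hmod] at hij
      rw [Fin.ext hij]
  calc (n / k) ^ k = (Set.range fun h => Set.range (vtx h)).ncard := by
        rw [← Set.image_univ, Set.ncard_image_of_injective _ hinj, Set.ncard_univ]
        simp
    _ ≤ _ := Set.ncard_le_ncard hsub (Set.toFinite _)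

/-! ### Passage to the limit and the special partitions. -/

theorem tendsto_pow_div_choose (k : ℕ) :
    Tendsto (fun n : ℕ => (n : ℝ) ^ k / (n.choose k : ℝ)) atTop (𝓝 (k ! : ℝ)) := by
  have hne : ∀ᶠ n : ℕ in atTop, (n.choose k : ℝ) ≠ 0 :=
    eventually_atTop.2 ⟨k, fun n hn => by exact_mod_cast (Nat.choose_pos hn).ne'⟩
  have h1 := (Asymptotics.isEquivalent_iff_tendsto_one hne).1 (isEquivalent_choose k).symm
  have h2 := h1.const_mul (k ! : ℝ)
  rw [mul_one] at h2
  refine h2.congr fun n => ?_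
  simp only [Pi.div_apply]
  have : (k ! : ℝ) ≠ 0 := by positivity
  field_simp

/-- Squeeze between `⌊n/k⌋^k` and `n^k/k^k + C n^(k-1)`, both asymptotic to `n^k/k^k`. -/
theorem hasTuranDensity_tent {k t ℓ : ℕ} (lam : Fin ℓ → ℕ) (hsum : ∑ i, lam i = k)
    (ht : 1 ≤ t) (hk : 1 ≤ k) (hsub : Set.Icc 1 t ⊆ subsetSums lam)
    (hT : ∑ j ∈ Finset.Icc (t + 1) k, (1 : ℝ) / j ≤ 1) :
    HasTuranDensity k {tent k lam} ((k ! : ℝ) / (k : ℝ) ^ k) := by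
  have hk0 : (0 : ℝ) < k := by exact_mod_cast hk
  set C : ℝ := ((k * (k + ℓ * k) : ℕ) : ℝ) with hC
  have hlow : Tendsto (fun n : ℕ => ((n : ℝ) ^ k / (n.choose k : ℝ)) *
      (((n / k : ℕ) : ℝ) / n) ^ k) atTop (𝓝 ((k ! : ℝ) / (k : ℝ) ^ k)) := by
    have h1 : Tendsto (fun n : ℕ => ((n / k : ℕ) : ℝ) / n) atTop (𝓝 (1 / k : ℝ)) := by
      have := (tendsto_nat_floor_mul_div_atTop (R := ℝ) (a := 1 / k) (by positivity)).comp
        tendsto_natCast_atTop_atTop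
      refine this.congr fun n => ?_
      simp only [Function.comp_apply]
      rw [one_div_mul_eq_div, Nat.floor_div_eq_div]
    have h2 := (tendsto_pow_div_choose k).mul (h1.pow k)
    rwa [one_div, inv_pow, ← div_eq_mul_inv] at h2
  have hup : Tendsto (fun n : ℕ => ((n : ℝ) ^ k / (n.choose k : ℝ)) *
      (1 / (k : ℝ) ^ k + C * (1 / n))) atTop (𝓝 ((k ! : ℝ) / (k : ℝ) ^ k)) := by
    have h1 : Tendsto (fun n : ℕ => 1 / (k : ℝ) ^ k + C * (1 / (n : ℝ))) atTop
        (𝓝 (1 / (k : ℝ) ^ k + C * 0)) :=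
      (tendsto_one_div_atTop_nhds_zero_nat.const_mul C).const_add _
    have h2 := (tendsto_pow_div_choose k).mul h1
    rwa [mul_zero, add_zero, mul_one_div] at h2
  refine tendsto_of_tendsto_of_tendsto_of_le_of_le' hlow hup ?_ ?_
  · filter_upwards [eventually_gt_atTop 0] with n hn
    have hn0 : (n : ℝ) ≠ 0 := by exact_mod_cast hn.ne'
    have h1 : ((n / k : ℕ) : ℝ) ^ k ≤ turanNumber k n {tent k lam} := by
      exact_mod_cast (div_pow_le_card_completePartite hk).trans
        (le_turanNumber (completePartite n k) rfl (fun e he => he.1) (by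
          rintro F rfl
          exact not_contains_tent_completePartite hk lam))
    refine le_trans (le_of_eq ?_) (div_le_div_of_nonneg_right h1 (Nat.cast_nonneg _))
    rw [div_pow]
    field_simp
  · filter_upwards [eventually_gt_atTop 0] with n hn
    have hn0 : (n : ℝ) ≠ 0 := by exact_mod_cast hn.ne'
    have h1 : (turanNumber k n {tent k lam} : ℝ) ≤
        (n : ℝ) ^ k / (k : ℝ) ^ k + C * (n : ℝ) ^ (k - 1) := by
      refine le_trans (Nat.cast_le.2 (turanNumber_le (m := ⌊(n : ℝ) ^ k / (k : ℝ) ^ k +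
        C * (n : ℝ) ^ (k - 1)⌋₊) fun G hGv hG hfree => Nat.le_floor ?_))
        (Nat.floor_le (by positivity))
      exact card_edgeSet_le_of_tent_free lam hsum ht hk hsub hT G hGv hG (hfree _ rfl)
    refine (div_le_div_of_nonneg_right h1 (Nat.cast_nonneg _)).trans (le_of_eq ?_)
    obtain ⟨m, rfl⟩ : ∃ m, k = m + 1 := ⟨k - 1, by omega⟩
    rw [Nat.add_sub_cancel, pow_succ]
    field_simp

theorem subsetSums_six_two_one : Set.Icc 1 3 ⊆ subsetSums ![6, 2, 1] := by
  rintro s ⟨h1, h3⟩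
  interval_cases s
  · exact ⟨{2}, by simp⟩
  · exact ⟨{1}, by simp⟩
  · exact ⟨{1, 2}, by simp⟩

/-- The parts equal to one in the tail already realise every sum up to `m`. -/
theorem Icc_subset_subsetSums_vecCons_ones (q m : ℕ) :
    Set.Icc 1 m ⊆ subsetSums (Matrix.vecCons q (fun _ : Fin m => 1)) := by
  rintro s ⟨-, hs⟩
  refine ⟨(initialCoords m s).map (Fin.succEmb m), ?_⟩
  rw [Finset.sum_map]
  simp [card_initialCoords hs]

end Hypergraph

theorem corollary2 :
    (∀ k : ℕ, 2 ≤ k → ∀ (ℓ : ℕ) (lam : Fin ℓ → ℕ), Hypergraph.IsPartition lam k →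
      Set.Icc 1 (Hypergraph.tentThreshold k) ⊆ Hypergraph.subsetSums lam →
      Hypergraph.HasTuranDensity k {Hypergraph.tent k lam} ((k ! : ℝ) / (k : ℝ) ^ k)) ∧
    Hypergraph.HasTuranDensity 9 {Hypergraph.tent 9 ![6, 2, 1]} ((9 ! : ℝ) / (9 : ℝ) ^ 9) ∧
    (∀ k : ℕ, 2 ≤ k → ∀ q : ℕ, 1 ≤ q → q + Hypergraph.tentThreshold k ≤ k →
      Hypergraph.HasTuranDensity k
        {Hypergraph.tent k (Matrix.vecCons q (fun _ : Fin (k - q) => 1))}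
        ((k ! : ℝ) / (k : ℝ) ^ k)) := by
  have main : ∀ k : ℕ, 2 ≤ k → ∀ (ℓ : ℕ) (lam : Fin ℓ → ℕ), ∑ i, lam i = k →
      Set.Icc 1 (Hypergraph.tentThreshold k) ⊆ Hypergraph.subsetSums lam →
      Hypergraph.HasTuranDensity k {Hypergraph.tent k lam} ((k ! : ℝ) / (k : ℝ) ^ k) :=
    fun k hk ℓ lam hsum hsub => Hypergraph.hasTuranDensity_tent lam hsum
      (Hypergraph.one_le_tentThreshold hk) (by omega) hsub (Hypergraph.sum_Icc_tentThreshold_le k)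
  refine ⟨fun k hk ℓ lam hlam hsub => main k hk ℓ lam hlam.2.2 hsub, ?_, fun k hk q _ hqk => ?_⟩
  · have := main 9 (by norm_num) 3 ![6, 2, 1] (by simp [Fin.sum_univ_succ])
      ((Set.Icc_subset_Icc_right Hypergraph.tentThreshold_nine_le).trans
        Hypergraph.subsetSums_six_two_one)
    exact_mod_cast this
  · refine main k hk _ _ ?_ ((Set.Icc_subset_Icc_right (by omega)).trans
      (Hypergraph.Icc_subset_subsetSums_vecCons_ones q (k - q)))
    rw [Fin.sum_univ_succ]
    simp
    omega
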